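/- **Setting.** Let $x^*\in\mathbb R^m$ and let $a>0$, $c\ge 1$, $\gamma,C,C_1,C_2,G>0$, $A,B\ge 0$ with $A+2B\|x^*\|^2>0$, and $r<\rho$ with $\|x^*\|\le\rho$ (all norms Euclidean). For a locally Lipschitz $V:\mathbb R^m\to\mathbb R$ let $\partial V(x)$ be the Clarke generalized gradient, i.e. the closed convex hull of all limits $\lim_i\nabla V(y_i)$ with $y_i\to x$ and $V$ differentiable at each $y_i$. Consider pairs $(V,F)$, $V:\mathbb R^m\to\mathbb R$ locally Lipschitz, $F:\mathbb R^m\to\mathbb R^m$ (the closed-loop drift), with $F(x^*)=0$ and 1. $\|F(x)-F(y)\|\le C\|x-y\|$ whenever $\|x\|,\|y\|\le\rho$; 2. $C_1\|x-x^*\|^a\le V(x)\le C_2\|x-x^*\|^a$ for all $x$; 3. $\|g\|\le G\|x-x^*\|^{a-1}$ for all $x$ and $g\in\partial V(x)$; 4. $\langle g,F(x)\rangle\le-\gamma V(x)^c$ for all $\|x\|\le\rho$ and $g\in\partial V(x)$. Given step sizes $\alpha_k$, consider random sequences in $\mathbb R^m$ with $x_{k+1}=x_k+\alpha_k(F(x_k)+w_k)$,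 where, with $\mathcal F_k=\sigma(x_0,w_0,\dots,x_{k-1},w_{k-1},x_k)$, the $w_k$ are square-integrable, $\mathbb E[w_k\mid\mathcal F_k]=0$, $\mathbb E[\|w_k\|^2\mid\mathcal F_k]\le A+B\|x_k\|^2$, and $\|x_k\|\le r$ almost surely for all $k\ge 0$. Write $E_k=\mathbb E\|x_k-x^*\|^2$. **Constants.** Given $\alpha,\mu,\mu_0>0$ put $$d_{a,c}=\tfrac{a(c-1)}2+1,\quad d=\tfrac{3d_{a,c}}{3d_{a,c}-1},\quad G_M=\tfrac2a\,G\,C_2^{\frac2a-1},\quad N_C=(C^2+1)(A+2B\|x^*\|^2),\quad \nu_4=\frac{2\gamma\,(C_1/C_2)^{c-1+\frac2a}}{a(1+\mu_0G_M)^2},$$ $$\phi=\tfrac12\,d_{a,c}\,\alpha^{2-\frac1{d_{a,c}}}\,\nu_4^{\frac1{d_{a,c}}}\Big(\tfrac{(\mu_0^2G_M^2+1)N_C}{2\mu}\Big)^{1-\frac1{d_{a,c}}},\qquad \omega=\frac{d_{a,c}\,\alpha^2(\mu_0^2G_M^2+1)N_C}{2\mu},\qquad \kappa=C_1^{-\frac2a}+2\mu_0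 .$$ **Theorem (a).** Let $\alpha,\mu>0$ and $0<\xi\le\frac{2d}3$. There is $K_0\ge 1$, depending only on $m,x^*,a,c,\gamma,C,C_1,C_2,G,A,B,r,\rho,\alpha,\mu,\xi$, such that for every real $K\ge K_0$, with $\alpha_k=\alpha/(k+K)^{\xi}$ and smoothing parameters $\mu_k=\mu/(k+K)^{\xi/2}$ (so that $\mu_0=\mu/K^{\xi/2}$ in the constants above), all $(V,F)$ and $(x_k,w_k)$ as above satisfy for all $k\ge 0$: * if $\xi=\frac{2d}3$, $$E_k\le E_0\,C_2^{\frac2a}\,\kappa\Big(\frac K{k+K}\Big)^{\phi}+\kappa\times\begin{cases}\dfrac1{(k+K)^{\phi}}\,\dfrac{2^d\omega}{d-1-\phi}&\text{if }\phi<d-1,\\[2mm]\dfrac{\log(k+K)}{(k+K)^{d-1}}\,2^d\omega&\text{if }\phi=d-1,\\[2mm]\dfrac1{(k+K)^{d-1}}\,\dfrac{e\,2^d\omega}{\phi-(d-1)}&\text{if }\phi>d-1;\end{cases}$$ * if $0<\xi<\frac{2d}3$, with $\xi'=\frac{(3d_{a,c}-1)\xi}{2d_{a,c}}\in(0,1)$,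 $$E_k\le E_0\,C_2^{\frac2a}\,\kappa\,\exp\Big[-\frac{\phi\big((k+K)^{1-\xi'}-K^{1-\xi'}\big)}{1-\xi'}\Big]+\frac{2\,\omega\,\kappa}{\phi\,(k+K)^{\xi/(2d_{a,c})}} .$$ **(b)** ($\xi=0$.) There is $\eta>0$, depending only on $m,x^*,a,c,\gamma,C,C_1,C_2,G,A,B,r,\rho$, such that whenever $\alpha>0$ and $0<\mu\le\eta$ satisfy $\alpha\mu+\alpha^2/\mu\le\eta\,\phi$ (where $\mu_0=\mu$), all $(V,F)$ and $(x_k,w_k)$ as above with $\alpha_k=\alpha$ satisfy, for all $k\ge 0$, $$E_k\le E_0\,C_2^{\frac2a}\,\kappa\,(1-\phi)^k+\frac{\omega\,\kappa}{\phi}.$$ -/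

import Mathlib

open MeasureTheory Filter Topology

noncomputable section

namespace NonsmoothSA

/-- The Clarke generalized gradient of `V` at `x`: the closed convex hull of all limits of
gradients `∇V(yᵢ)` along sequences `yᵢ → x` of points at which `V` is differentiable. -/
def clarkeGradient {E : Type*} [NormedAddCommGroup E] [InnerProductSpace ℝ E] [CompleteSpace E]
    (V : E → ℝ) (x : E) : Set E :=
  closure (convexHull ℝ
    {g : E | ∃ y : ℕ → E, (∀ i, DifferentiableAt ℝ V (y i)) ∧ Tendsto y atTop (𝓝 x) ∧
      Tendsto (fun i => gradient V (y i)) atTop (𝓝 g)})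

/-- The assumptions on the Lyapunov function `V` and the closed-loop drift `F`.  The growth
conditions on `V` hold on the whole space; the Lipschitz condition on `F` and the stability
condition are only required on the ball of radius `ρ` (for `c > 1` they cannot hold together on
the whole space). -/
structure SystemAssumptions {m : ℕ} (V : EuclideanSpace ℝ (Fin m) → ℝ)
    (F : EuclideanSpace ℝ (Fin m) → EuclideanSpace ℝ (Fin m)) (xs : EuclideanSpace ℝ (Fin m))
    (a c γ C C₁ C₂ G ρ : ℝ) : Prop where
  /-- `V` is locally Lipschitz. -/
  locallyLipschitz : LocallyLipschitz V
  /-- `xs` is a stationary point of the drift. -/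
  stationary : F xs = 0
  /-- `F` is `C`-Lipschitz on the ball of radius `ρ`. -/
  lipschitz : ∀ x y, ‖x‖ ≤ ρ → ‖y‖ ≤ ρ → ‖F x - F y‖ ≤ C * ‖x - y‖
  /-- Polynomial growth of `V`. -/
  growth : ∀ x, C₁ * ‖x - xs‖ ^ a ≤ V x ∧ V x ≤ C₂ * ‖x - xs‖ ^ a
  /-- Growth of the generalized gradients of `V`. -/
  gradientGrowth : ∀ x, ∀ g ∈ clarkeGradient V x, ‖g‖ ≤ G * ‖x - xs‖ ^ (a - 1)
  /-- Sub-exponential stability. -/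
  stability : ∀ x, ‖x‖ ≤ ρ → ∀ g ∈ clarkeGradient V x, inner ℝ g (F x) ≤ -γ * V x ^ c

/-- The σ-algebra generated by `x₀, w₀, …, x_{k-1}, w_{k-1}, x_k`. -/
@[reducible]
def history {m : ℕ} {Ω : Type*} (x w : ℕ → Ω → EuclideanSpace ℝ (Fin m)) (k : ℕ) :
    MeasurableSpace Ω :=
  (⨆ j ∈ Set.Iic k, MeasurableSpace.comap (x j) inferInstance) ⊔
    (⨆ j ∈ Set.Iio k, MeasurableSpace.comap (w j) inferInstance)

/-- `x` is a trajectory of stochastic approximation `x_{k+1} = x_k + α_k (F(x_k) + w_k)` with step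
sizes `step`, conditionally centred noise `w` whose conditional second moment is at most
`A + B ‖x_k‖²`, and iterates bounded by `r`. -/
structure IsTrajectory {m : ℕ} {Ω : Type*} [MeasurableSpace Ω] (P : Measure Ω)
    (F : EuclideanSpace ℝ (Fin m) → EuclideanSpace ℝ (Fin m)) (step : ℕ → ℝ) (A B r : ℝ)
    (x w : ℕ → Ω → EuclideanSpace ℝ (Fin m)) : Prop where
  measurable_x : ∀ k, Measurable (x k)
  measurable_w : ∀ k, Measurable (w k)
  /-- The noise is square-integrable. -/
  memLp_w : ∀ k, MemLp (w k) 2 P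
  update : ∀ k, ∀ᵐ ω ∂P, x (k + 1) ω = x k ω + step k • (F (x k ω) + w k ω)
  unbiased : ∀ k, P[w k | history x w k] =ᵐ[P] 0
  variance : ∀ k, P[fun ω => ‖w k ω‖ ^ 2 | history x w k] ≤ᵐ[P] fun ω => A + B * ‖x k ω‖ ^ 2
  /-- The iterates are bounded. -/
  bounded : ∀ k, ∀ᵐ ω ∂P, ‖x k ω‖ ≤ r

/-- The mean square error `E_k = 𝔼 ‖x_k - xs‖²`. -/
def mse {m : ℕ} {Ω : Type*} [MeasurableSpace Ω] (P : Measure Ω)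
    (x : ℕ → Ω → EuclideanSpace ℝ (Fin m)) (xs : EuclideanSpace ℝ (Fin m)) (k : ℕ) : ℝ :=
  ∫ ω, ‖x k ω - xs‖ ^ 2 ∂P

/-- `d_{a,c} = a (c - 1) / 2 + 1`. -/
def dac (a c : ℝ) : ℝ := a * (c - 1) / 2 + 1

/-- `d = 3 d_{a,c} / (3 d_{a,c} - 1)`. -/
def dExp (a c : ℝ) : ℝ := 3 * dac a c / (3 * dac a c - 1)

/-- `G_M = (2 / a) G C₂^{2/a - 1}`. -/
def gM (a G C₂ : ℝ) : ℝ := 2 / a * G * C₂ ^ (2 / a - 1)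

/-- `N_C = (C² + 1) (A + 2 B s²)`, where `s` is the norm of the equilibrium. -/
def nC (C A B s : ℝ) : ℝ := (C ^ 2 + 1) * (A + 2 * B * s ^ 2)

/-- `ν₄ = 2 γ (C₁ / C₂)^{c - 1 + 2/a} / (a (1 + μ₀ G_M)²)`. -/
def nu4 (a c γ C₁ C₂ G μ₀ : ℝ) : ℝ :=
  2 * γ * (C₁ / C₂) ^ (c - 1 + 2 / a) / (a * (1 + μ₀ * gM a G C₂) ^ 2)

/-- `(μ₀² G_M² + 1) N_C / (2 μ)`. -/
def noiseLevel (a C C₂ G A B s μ μ₀ : ℝ) : ℝ :=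
  (μ₀ ^ 2 * gM a G C₂ ^ 2 + 1) * nC C A B s / (2 * μ)

/-- `φ = ½ d_{a,c} α^{2 - 1/d_{a,c}} ν₄^{1/d_{a,c}} ((μ₀² G_M² + 1) N_C / (2 μ))^{1 - 1/d_{a,c}}`. -/
def phi (a c γ C C₁ C₂ G A B s α μ μ₀ : ℝ) : ℝ :=
  1 / 2 * dac a c * α ^ (2 - 1 / dac a c) * nu4 a c γ C₁ C₂ G μ₀ ^ (1 / dac a c) *
    noiseLevel a C C₂ G A B s μ μ₀ ^ (1 - 1 / dac a c)

/-- `ω = d_{a,c} α² (μ₀² G_M² + 1) N_C / (2 μ)`. -/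
def omega (a c C C₂ G A B s α μ μ₀ : ℝ) : ℝ :=
  dac a c * α ^ 2 * noiseLevel a C C₂ G A B s μ μ₀

/-- `1 / C₁^{2/a} + 2 μ₀`. -/
def envelopeConst (a C₁ μ₀ : ℝ) : ℝ := 1 / C₁ ^ (2 / a) + 2 * μ₀

end NonsmoothSA

end

/-!
The Lyapunov function of the analysis is the Moreau envelope `M_μ` of `W = V ^ (2 / a)`, which is
comparable to `‖x - x*‖²`. It is semiconcave: for a proximal point `y` of `x`,
`M_μ(x + v) ≤ M_μ(x) + ⟨v, x - y⟩ / μ + ‖v‖² / (2 μ)`, so that the noise enters only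
through its second moment. The vector `(x - y) / μ` is a positive multiple of a Clarke gradient of
`V` at `y`, hence the stability condition, with the Lipschitz bound for `F` used to pass from `F x`
to `F y`, gives a decrease proportional to `M_μ(x) ^ d_{a,c}`. Bounding this power from below by a
tangent line makes the recursion for the means affine; the point of tangency is chosen to balance
the linear decrease against the noise, which produces the rate `φ`.
-/

namespace NonsmoothSA

section ClarkeGradient

/-! ### The Clarke gradient -/

theorem sub_le_mul_of_ae_deriv_le {h : ℝ → ℝ} {K : NNReal} (hh : LipschitzWith K h) {t u : ℝ}
    (ht : 0 ≤ t) (hu : ∀ᵐ s, s ∈ Set.Icc 0 t → deriv h s ≤ u) : h t - h 0 ≤ t * u := by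
  have hac : AbsolutelyContinuousOnInterval h 0 t :=
    hh.lipschitzOnWith.absolutelyContinuousOnInterval
  calc h t - h 0 = ∫ s in (0)..t, deriv h s := hac.integral_deriv_eq_sub.symm
    _ ≤ ∫ _ in (0)..t, u :=
        intervalIntegral.integral_mono_ae_restrict ht hac.intervalIntegrable_deriv
          intervalIntegrable_const ((ae_restrict_iff' measurableSet_Icc).2 hu)
    _ = t * u := by simp

variable {E : Type*} [NormedAddCommGroup E]

theorem ae_ae_differentiableAt_add_smul [NormedSpace ℝ E] [FiniteDimensional ℝ E]
    [MeasurableSpace E] [BorelSpace E] (μ : Measure E) [μ.IsAddHaarMeasure] {g : E → ℝ}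
    {K : NNReal} (hg : LipschitzWith K g) (v : E) :
    ∀ᵐ z ∂μ, ∀ᵐ s : ℝ, DifferentiableAt ℝ g (z + s • v) := by
  have hmeas : MeasurableSet {q : ℝ × E | DifferentiableAt ℝ g (q.2 + q.1 • v)} :=
    (measurableSet_of_differentiableAt ℝ g).preimage
      (by fun_prop : Measurable fun q : ℝ × E => q.2 + q.1 • v)
  refine (Measure.ae_ae_comm hmeas).1 (Eventually.of_forall fun s => ?_)
  exact (measurePreserving_add_right μ (s • v)).quasiMeasurePreserving.ae hg.ae_differentiableAt

/-- By Fubini the estimate holds along almost every parallel segment, and continuity passes it to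
the given one, which may miss the points of differentiability altogether. -/
theorem apply_add_smul_le_of_fderiv_le [NormedSpace ℝ E] [FiniteDimensional ℝ E] {g : E → ℝ}
    {K : NNReal} (hg : LipschitzWith K g) {y v : E} {δ u t : ℝ}
    (hu : ∀ z ∈ Metric.ball y δ, DifferentiableAt ℝ g z → fderiv ℝ g z v ≤ u)
    (ht : 0 ≤ t) (htδ : t * ‖v‖ < δ) : g (y + t • v) ≤ g y + t * u := by
  borelize E
  have hdense := Measure.dense_of_ae
    (ae_ae_differentiableAt_add_smul (Measure.addHaar : Measure E) hg v)
  have hshift : Continuous fun z => g (z + t • v) := hg.continuous.comp (by fun_prop)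
  refine le_of_tendsto_of_tendsto_of_frequently hshift.continuousAt
    (hg.continuous.add (continuous_const (y := t * u))).continuousAt
    (((mem_closure_iff_frequently.1 (hdense y)).and_eventually
      (Metric.ball_mem_nhds y (sub_pos.2 htδ))).mono ?_)
  rintro z ⟨hz, hzy⟩
  have hline : LipschitzWith (K * ‖v‖₊) fun s : ℝ => g (z + s • v) :=
    hg.comp <| LipschitzWith.of_dist_le_mul fun s s' => le_of_eq <| by
      rw [dist_eq_norm, add_sub_add_left_eq_sub, ← sub_smul, norm_smul, dist_eq_norm, mul_comm,
        coe_nnnorm]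
  have hderiv : ∀ᵐ s : ℝ, s ∈ Set.Icc 0 t → deriv (fun s : ℝ => g (z + s • v)) s ≤ u := by
    filter_upwards [hz] with s hs hst
    have hball : z + s • v ∈ Metric.ball y δ := by
      have hsv : ‖s • v‖ ≤ t * ‖v‖ := by
        rw [norm_smul, Real.norm_of_nonneg hst.1]
        exact mul_le_mul_of_nonneg_right hst.2 (norm_nonneg v)
      rw [dist_eq_norm] at hzy
      rw [mem_ball_iff_norm, add_sub_right_comm]
      linarith [norm_add_le (z - y) (s • v)]
    have hpath : HasDerivAt (fun s : ℝ => z + s • v) v s := by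
      simpa using ((hasDerivAt_id s).smul_const v).const_add z
    exact (hs.hasFDerivAt.comp_hasDerivAt s hpath).deriv.trans_le (hu _ hball hs)
  simpa [add_comm] using sub_le_mul_of_ae_deriv_le hline ht hderiv

variable [InnerProductSpace ℝ E] [FiniteDimensional ℝ E] {V : E → ℝ} {y v : E} {u : ℝ}

theorem eventually_fderiv_le_of_clarkeGradient (hV : LocallyLipschitz V)
    (hu : ∀ g ∈ clarkeGradient V y, inner ℝ g v < u) :
    ∀ᶠ z in 𝓝 y, DifferentiableAt ℝ V z → fderiv ℝ V z v ≤ u := by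
  obtain ⟨K, s, hs, hK⟩ := hV y
  by_contra hfreq
  simp only [not_eventually, Classical.not_imp, not_le] at hfreq
  obtain ⟨z, hzy, hz⟩ := exists_seq_forall_of_frequently
    (hfreq.and_eventually (eventually_eventually_nhds.2 hs))
  have hbdd : ∀ n, gradient V (z n) ∈ Metric.closedBall (0 : E) K := fun n => by
    rw [mem_closedBall_zero_iff, gradient, LinearIsometryEquiv.norm_map]
    exact norm_fderiv_le_of_lipschitzOn ℝ (hz n).2 hK
  obtain ⟨g, -, φ, hφ, hg⟩ := tendsto_subseq_of_bounded Metric.isBounded_closedBall hbdd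
  have hgV : g ∈ clarkeGradient V y := subset_closure <| subset_convexHull ℝ _
    ⟨z ∘ φ, fun i => (hz _).1.1, hzy.comp hφ.tendsto_atTop, hg⟩
  refine (hu g hgV).not_ge (ge_of_tendsto (hg.inner tendsto_const_nhds) ?_)
  refine Eventually.of_forall fun n => ?_
  simp only [Function.comp_apply, gradient, InnerProductSpace.toDual_symm_apply]
  exact (hz _).1.2.le

theorem eventually_apply_add_smul_le_of_clarkeGradient (hV : LocallyLipschitz V)
    (hu : ∀ g ∈ clarkeGradient V y, inner ℝ g v < u) :
    ∀ᶠ t in 𝓝[>] (0 : ℝ), V (y + t • v) ≤ V y + t * u := by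
  obtain ⟨K, s, hs, hK⟩ := hV y
  obtain ⟨δ, hδ, hball⟩ := Metric.mem_nhds_iff.1
    (inter_mem hs (eventually_fderiv_le_of_clarkeGradient hV hu))
  obtain ⟨g, hg, hVg⟩ := (hK.mono (hball.trans Set.inter_subset_left)).extend_real
  have hgu : ∀ z ∈ Metric.ball y δ, DifferentiableAt ℝ g z → fderiv ℝ g z v ≤ u := fun z hz hd => by
    have hgV : g =ᶠ[𝓝 z] V := by
      filter_upwards [Metric.isOpen_ball.mem_nhds hz] with w hw using (hVg hw).symm
    rw [hgV.fderiv_eq]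
    exact (hball hz).2 (hgV.differentiableAt_iff.1 hd)
  have hsmall : ∀ᶠ t in 𝓝[>] (0 : ℝ), t * ‖v‖ < δ :=
    mem_nhdsWithin_of_mem_nhds <| (continuous_mul_const ‖v‖).continuousAt.eventually_lt
      continuousAt_const (by simpa using hδ)
  filter_upwards [self_mem_nhdsWithin, hsmall] with t ht htδ
  have hmem : y + t • v ∈ Metric.ball y δ := by
    rw [mem_ball_iff_norm, add_sub_cancel_left, norm_smul, Real.norm_of_nonneg (le_of_lt ht)]
    exact htδ
  rw [hVg hmem, hVg (Metric.mem_ball_self hδ)]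
  exact apply_add_smul_le_of_fderiv_le hg hgu (le_of_lt ht) htδ

theorem mem_clarkeGradient_of_minorant (hV : LocallyLipschitz V) {ψ : E → ℝ} {p : E}
    (hψ : HasGradientAt ψ p y) (hle : ∀ᶠ z in 𝓝 y, ψ z ≤ V z) (heq : ψ y = V y) :
    p ∈ clarkeGradient V y := by
  by_contra hp
  obtain ⟨f, u, hfu, hup⟩ := geometric_hahn_banach_closed_point
    (convex_convexHull ℝ _).closure isClosed_closure hp
  set v := (InnerProductSpace.toDual ℝ E).symm f with hv
  have hf : ∀ g, f g = inner ℝ g v := fun g => by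
    rw [hv, real_inner_comm, InnerProductSpace.toDual_symm_apply]
  have hpath : HasDerivAt (fun t : ℝ => y + t • v) v 0 := by
    simpa using ((hasDerivAt_id (0 : ℝ)).smul_const v).const_add y
  have hslope : Tendsto (fun t : ℝ => t⁻¹ • (ψ (y + t • v) - ψ y)) (𝓝[>] 0) (𝓝 (inner ℝ p v)) := by
    have hψ0 : HasFDerivAt ψ (InnerProductSpace.toDual ℝ E p) (y + (0 : ℝ) • v) := by
      simpa using hψ.hasFDerivAt
    simpa using (hψ0.comp_hasDerivAt 0 hpath).tendsto_slope_zero_right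
  have htend : Tendsto (fun t : ℝ => y + t • v) (𝓝[>] 0) (𝓝 y) := by
    simpa using hpath.continuousAt.tendsto.mono_left (nhdsWithin_le_nhds (s := Set.Ioi 0))
  refine (hup.trans_eq (hf p)).not_ge (le_of_tendsto hslope ?_)
  filter_upwards [self_mem_nhdsWithin, htend.eventually hle,
    eventually_apply_add_smul_le_of_clarkeGradient hV fun g hg => hf g ▸ hfu g hg]
    with t ht hψV hVu
  rw [smul_eq_mul, inv_mul_le_iff₀ ht, heq]
  linarith

end ClarkeGradient

section Envelope

/-! ### Moreau envelopes -/

variable {E : Type*} [NormedAddCommGroup E] {W : E → ℝ} {μ : ℝ} {x y : E}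

/-- The Moreau envelope of `W` with smoothing parameter `μ`, the regularization of `W` on which the
descent argument runs. As an infimum of reals it is meaningful only for `W` bounded below. -/
noncomputable def moreauEnvelope (W : E → ℝ) (μ : ℝ) (x : E) : ℝ :=
  ⨅ y, (W y + ‖x - y‖ ^ 2 / (2 * μ))

/-- `y` is a proximal point of `x`: it attains the infimum defining the Moreau envelope at `x`. -/
def IsProx (W : E → ℝ) (μ : ℝ) (x y : E) : Prop :=
  ∀ z, W y + ‖x - y‖ ^ 2 / (2 * μ) ≤ W z + ‖x - z‖ ^ 2 / (2 * μ)

theorem moreauEnvelope_le (hW : ∀ z, 0 ≤ W z) (hμ : 0 < μ) (x z : E) :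
    moreauEnvelope W μ x ≤ W z + ‖x - z‖ ^ 2 / (2 * μ) :=
  ciInf_le ⟨0, by rintro _ ⟨y, rfl⟩; exact add_nonneg (hW y) (by positivity)⟩ z

theorem moreauEnvelope_le_self (hW : ∀ z, 0 ≤ W z) (hμ : 0 < μ) (x : E) :
    moreauEnvelope W μ x ≤ W x := by
  simpa using moreauEnvelope_le hW hμ x x

theorem moreauEnvelope_nonneg (hW : ∀ z, 0 ≤ W z) (hμ : 0 < μ) (x : E) :
    0 ≤ moreauEnvelope W μ x :=
  le_ciInf fun y => add_nonneg (hW y) (by positivity)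

theorem IsProx.moreauEnvelope_eq (h : IsProx W μ x y) (hW : ∀ z, 0 ≤ W z) (hμ : 0 < μ) :
    moreauEnvelope W μ x = W y + ‖x - y‖ ^ 2 / (2 * μ) :=
  le_antisymm (moreauEnvelope_le hW hμ x y) (le_ciInf h)

theorem IsProx.apply_le_moreauEnvelope (h : IsProx W μ x y) (hW : ∀ z, 0 ≤ W z) (hμ : 0 < μ) :
    W y ≤ moreauEnvelope W μ x := by
  rw [h.moreauEnvelope_eq hW hμ]
  exact le_add_of_nonneg_right (by positivity)

variable [InnerProductSpace ℝ E]

theorem IsProx.moreauEnvelope_add_le (h : IsProx W μ x y) (hW : ∀ z, 0 ≤ W z) (hμ : 0 < μ)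
    (v : E) : moreauEnvelope W μ (x + v)
      ≤ moreauEnvelope W μ x + inner ℝ (x - y) v / μ + ‖v‖ ^ 2 / (2 * μ) := by
  refine (moreauEnvelope_le hW hμ _ y).trans (le_of_eq ?_)
  rw [h.moreauEnvelope_eq hW hμ, add_sub_right_comm, norm_add_sq_real]
  field_simp
  ring

theorem IsProx.eq_of_le_sq {q : ℝ} {z₀ : E} (h : IsProx W μ x z₀) (hμ : 0 < μ) (hz₀ : 0 ≤ W z₀)
    (hW : ∀ z, W z ≤ q * ‖z - z₀‖ ^ 2) : x = z₀ := by
  have : 0 < 2 * μ * |q| + 1 := by positivity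
  have hle : ∀ t : ℝ, ‖x - z₀‖ ^ 2 ≤ (2 * μ * |q| * t ^ 2 + (1 - t) ^ 2) * ‖x - z₀‖ ^ 2 := by
    intro t
    have hprox := h (z₀ + t • (x - z₀))
    have hgrowth := (hW (z₀ + t • (x - z₀))).trans
      (mul_le_mul_of_nonneg_right (le_abs_self q) (by positivity))
    rw [add_sub_cancel_left, norm_smul, mul_pow, Real.norm_eq_abs, sq_abs] at hgrowth
    rw [show x - (z₀ + t • (x - z₀)) = (1 - t) • (x - z₀) by module, norm_smul, mul_pow,
      Real.norm_eq_abs, sq_abs] at hprox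
    have := mul_le_mul_of_nonneg_left ((le_add_of_nonneg_left hz₀).trans
      (hprox.trans (add_le_add_left hgrowth _))) (by positivity : 0 ≤ 2 * μ)
    field_simp at this
    linarith
  have ht : 2 * μ * |q| * (1 / (2 * μ * |q| + 1)) ^ 2 + (1 - 1 / (2 * μ * |q| + 1)) ^ 2
      = 1 - 1 / (2 * μ * |q| + 1) := by
    field_simp
    ring
  have hzero := hle (1 / (2 * μ * |q| + 1))
  rw [ht, sub_mul, one_mul, le_sub_self_iff] at hzero
  have : ‖x - z₀‖ ^ 2 ≤ 0 := nonpos_of_mul_nonpos_right hzero (by positivity)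
  exact sub_eq_zero.1 (norm_eq_zero.1 (pow_eq_zero_iff two_ne_zero |>.1 (by nlinarith)))

theorem hasGradientAt_sub_sq_norm_sub [CompleteSpace E] (k μ : ℝ) (x y : E) :
    HasGradientAt (fun z => k - ‖x - z‖ ^ 2 / (2 * μ)) (μ⁻¹ • (x - y)) y := by
  have hsq := ((hasFDerivAt_id (𝕜 := ℝ) y).const_sub x).norm_sq
  refine (((hsq.mul_const (2 * μ)⁻¹).const_sub k).congr_fderiv ?_).congr_of_eventuallyEq
    (Eventually.of_forall fun z => by simp [div_eq_mul_inv])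
  ext v
  simp only [mul_inv_rev, id_eq, map_sub, ContinuousLinearMap.comp_neg,
    ContinuousLinearMap.comp_id, neg_sub, neg_apply, smul_apply, sub_apply, coe_innerSL_apply,
    nsmul_eq_mul, Nat.cast_ofNat, smul_eq_mul, map_smul, InnerProductSpace.toDual_apply_apply]
  field_simp
  ring

variable [FiniteDimensional ℝ E]

theorem exists_isProx (hW : Continuous W) (hW0 : ∀ z, 0 ≤ W z) (hμ : 0 < μ) (x : E) :
    ∃ y, IsProx W μ x y := by
  have : ProperSpace E := FiniteDimensional.proper ℝ E
  refine Continuous.exists_forall_le (f := fun z => W z + ‖x - z‖ ^ 2 / (2 * μ)) (by fun_prop) ?_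
  refine tendsto_atTop_mono (fun z => le_add_of_nonneg_left (hW0 z)) ?_
  refine Tendsto.atTop_div_const (by positivity) ((tendsto_pow_atTop two_ne_zero).comp ?_)
  refine tendsto_atTop_mono (fun z => ?_)
    (tendsto_atTop_add_const_right _ (-‖x‖) (tendsto_norm_cocompact_atTop (E := E)))
  rw [norm_sub_rev]
  exact norm_sub_norm_le z x

theorem convexOn_sub_moreauEnvelope (hW : Continuous W) (hW0 : ∀ z, 0 ≤ W z) (hμ : 0 < μ) :
    ConvexOn ℝ Set.univ fun x => ‖x‖ ^ 2 / (2 * μ) - moreauEnvelope W μ x := by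
  refine ⟨convex_univ, fun b _ c _ s t hs ht hst => ?_⟩
  obtain ⟨y, hy⟩ := exists_isProx hW hW0 hμ (s • b + t • c)
  -- The function is a supremum of affine functions, attained at the convex combination by `y`.
  let ℓ : E → ℝ := fun x => inner ℝ x y / μ - (W y + ‖y‖ ^ 2 / (2 * μ))
  have hℓ : ∀ x : E, ‖x‖ ^ 2 / (2 * μ) - (W y + ‖x - y‖ ^ 2 / (2 * μ)) = ℓ x := fun x => by
    simp only [ℓ, norm_sub_sq_real]
    field_simp
    ring
  have hle : ∀ x, ℓ x ≤ ‖x‖ ^ 2 / (2 * μ) - moreauEnvelope W μ x := fun x => by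
    rw [← hℓ]
    exact sub_le_sub_left (moreauEnvelope_le hW0 hμ x y) _
  calc ‖s • b + t • c‖ ^ 2 / (2 * μ) - moreauEnvelope W μ (s • b + t • c)
      = s * ℓ b + t * ℓ c := by
        rw [hy.moreauEnvelope_eq hW0 hμ, hℓ]
        simp only [ℓ, inner_add_left, real_inner_smul_left]
        linear_combination (-(W y + ‖y‖ ^ 2 / (2 * μ))) * -hst
    _ ≤ _ := by
        simp only [smul_eq_mul]
        gcongr
        exacts [hle b, hle c]

theorem continuous_moreauEnvelope (hW : Continuous W) (hW0 : ∀ z, 0 ≤ W z) (hμ : 0 < μ) :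
    Continuous (moreauEnvelope W μ) := by
  have hconv := (convexOn_sub_moreauEnvelope hW hW0 hμ).continuousOn isOpen_univ
  have hquad : Continuous fun x : E => ‖x‖ ^ 2 / (2 * μ) := by fun_prop
  simpa only [Pi.sub_def, sub_sub_cancel] using hquad.sub (continuousOn_univ.1 hconv)

/-- The power `V ^ s` is touched from below at `y` by a quadratic; taking the root `1 / s` gives a
smooth minorant of `V` itself. -/
theorem IsProx.exists_mem_clarkeGradient {V : E → ℝ} {s : ℝ}
    (h : IsProx (fun z => V z ^ s) μ x y) (hV : LocallyLipschitz V) (hV0 : ∀ z, 0 ≤ V z)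
    (hs : 0 < s) (hy : 0 < V y) :
    ∃ g ∈ clarkeGradient V y, μ⁻¹ • (x - y) = (s * V y ^ (s - 1)) • g := by
  let b : E → ℝ := fun z => V y ^ s + ‖x - y‖ ^ 2 / (2 * μ) - ‖x - z‖ ^ 2 / (2 * μ)
  have hby : b y = V y ^ s := by simp [b]
  have hby0 : 0 < b y := by rw [hby]; positivity
  have hb : HasGradientAt b (μ⁻¹ • (x - y)) y := hasGradientAt_sub_sq_norm_sub _ μ x y
  have hroot : ∀ z, (V z ^ s) ^ s⁻¹ = V z := fun z => Real.rpow_rpow_inv (hV0 z) hs.ne'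
  have hscale : V y ^ (s - 1) * V y ^ (1 - s) = 1 := by
    rw [← Real.rpow_add hy]
    simp
  refine ⟨(s⁻¹ * V y ^ (1 - s)) • (μ⁻¹ • (x - y)),
    mem_clarkeGradient_of_minorant (ψ := fun z => b z ^ s⁻¹) hV ?_ ?_ ?_, ?_⟩
  · rw [hasGradientAt_iff_hasFDerivAt]
    refine (hb.hasFDerivAt.rpow_const (p := s⁻¹) (Or.inl hby0.ne')).congr_fderiv ?_
    rw [hby, ← Real.rpow_mul hy.le, mul_sub, mul_inv_cancel₀ hs.ne', mul_one]
    simp only [map_smul]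
  · filter_upwards [hb.continuousAt.eventually (lt_mem_nhds hby0)] with z hz
    rw [← hroot z]
    exact Real.rpow_le_rpow hz.le (sub_le_iff_le_add.2 (h z)) (by positivity)
  · simp only [hby, hroot]
  · rw [smul_smul, show s * V y ^ (s - 1) * (s⁻¹ * V y ^ (1 - s)) =
      s * s⁻¹ * (V y ^ (s - 1) * V y ^ (1 - s)) by ring, hscale, mul_inv_cancel₀ hs.ne', one_mul,
      one_smul]

end Envelope

section ProximalLyapunov

/-! ### Proximal Lyapunov functions -/

/-- The numerical constants of the descent argument: `W` is a function with
`p ‖z - z₀‖² ≤ W z ≤ q ‖z - z₀‖²` whose subgradients have norm at most `S ‖z - z₀‖` and which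
decays along the drift at rate `β W ^ D`; the drift is `L`-Lipschitz on the ball of radius `ρ`,
the iterates stay in the smaller ball of radius `r`, `s` is the norm of `z₀`, and the noise has
conditional variance at most `A + B ‖·‖²`. -/
structure DescentConstants where
  (p q S β D L A B s r ρ : ℝ)
  p_pos : 0 < p
  q_pos : 0 < q
  S_pos : 0 < S
  β_pos : 0 < β
  one_le_D : 1 ≤ D
  L_pos : 0 < L
  B_nonneg : 0 ≤ B
  noise_pos : 0 < A + 2 * B * s ^ 2
  s_le_ρ : s ≤ ρ
  r_lt_ρ : r < ρ

namespace DescentConstants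

variable (k : DescentConstants)

/-- The constant `Λ` in `‖x - y‖² ≤ Λ μ² M(x)`, for `y` a proximal point of `x` and `M` the
envelope of parameter `μ`. -/
noncomputable def curvature : ℝ := k.S ^ 2 / k.p

/-- The constant `κ(μ)` in `‖x - z₀‖² ≤ κ(μ) M(x)`, for `M` the envelope of parameter `μ`. -/
noncomputable def comparison (μ : ℝ) : ℝ := 1 / k.p + 2 * μ

/-- The smallness of `μ` which keeps the proximal points of the ball of radius `r` in the ball of
radius `ρ`. -/
def IsSmallSmoothing (μ : ℝ) : Prop :=
  μ ^ 2 * k.curvature * (k.q * (2 * k.ρ) ^ 2) ≤ (k.ρ - k.r) ^ 2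

theorem D_pos : 0 < k.D := one_pos.trans_le k.one_le_D

theorem curvature_pos : 0 < k.curvature := div_pos (pow_pos k.S_pos 2) k.p_pos

theorem comparison_pos {μ : ℝ} (hμ : 0 < μ) : 0 < k.comparison μ :=
  add_pos (one_div_pos.2 k.p_pos) (by positivity)

theorem comparison_le_comparison {μ μ' : ℝ} (hle : μ' ≤ μ) : k.comparison μ' ≤ k.comparison μ := by
  unfold comparison
  gcongr

theorem IsSmallSmoothing.mono {k : DescentConstants} {μ μ' : ℝ} (h : k.IsSmallSmoothing μ)
    (hμ' : 0 ≤ μ') (hle : μ' ≤ μ) : k.IsSmallSmoothing μ' := by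
  have := k.curvature_pos
  have := k.q_pos
  refine le_trans ?_ h
  gcongr

theorem distortion_le_distortion {μ μ' : ℝ} (hμ' : 0 ≤ μ') (hle : μ' ≤ μ) :
    ((1 + μ' * k.S) ^ 2) ^ k.D ≤ ((1 + μ * k.S) ^ 2) ^ k.D := by
  have := k.S_pos
  have := k.D_pos
  gcongr

end DescentConstants

/-- `W` is a Lyapunov function for the drift `F` at `z₀`, described through the proximal points `y`
of `W`: the vector `μ⁻¹ (x - y)` plays the role of a subgradient of `W` at `y`. -/
structure IsProximalLyapunov {E : Type*} [NormedAddCommGroup E] [InnerProductSpace ℝ E]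
    (k : DescentConstants) (W : E → ℝ) (F : E → E) (z₀ : E) : Prop where
  continuous : Continuous W
  le_apply : ∀ z, k.p * ‖z - z₀‖ ^ 2 ≤ W z
  apply_le : ∀ z, W z ≤ k.q * ‖z - z₀‖ ^ 2
  norm_sub_prox_le : ∀ {μ x y}, 0 < μ → IsProx W μ x y → ‖x - y‖ ≤ μ * k.S * ‖y - z₀‖
  inner_prox_le : ∀ {μ x y}, 0 < μ → IsProx W μ x y → ‖y‖ ≤ k.ρ →
    inner ℝ (x - y) (F y) ≤ -(μ * (k.β * W y ^ k.D))
  norm_stationary : ‖z₀‖ = k.s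
  stationary : F z₀ = 0
  lipschitz : ∀ x y, ‖x‖ ≤ k.ρ → ‖y‖ ≤ k.ρ → ‖F x - F y‖ ≤ k.L * ‖x - y‖

namespace IsProximalLyapunov

variable {E : Type*} [NormedAddCommGroup E] [InnerProductSpace ℝ E] {k : DescentConstants}
  {W : E → ℝ} {F : E → E} {z₀ x y : E} {μ : ℝ}

theorem nonneg (h : IsProximalLyapunov k W F z₀) (z : E) : 0 ≤ W z :=
  (mul_nonneg k.p_pos.le (sq_nonneg _)).trans (h.le_apply z)

theorem norm_drift_le (h : IsProximalLyapunov k W F z₀) (hx : ‖x‖ ≤ k.ρ) :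
    ‖F x‖ ≤ k.L * ‖x - z₀‖ := by
  simpa [h.stationary] using h.lipschitz x z₀ hx (h.norm_stationary.trans_le k.s_le_ρ)

theorem norm_sub_stationary_le (h : IsProximalLyapunov k W F z₀) (hx : ‖x‖ ≤ k.ρ) :
    ‖x - z₀‖ ≤ 2 * k.ρ := by
  linarith [norm_sub_le x z₀, h.norm_stationary, k.s_le_ρ]

theorem envelope_nonneg (h : IsProximalLyapunov k W F z₀) (hμ : 0 < μ) (x : E) :
    0 ≤ moreauEnvelope W μ x :=
  moreauEnvelope_nonneg h.nonneg hμ x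

theorem envelope_le (h : IsProximalLyapunov k W F z₀) (hμ : 0 < μ) (x : E) :
    moreauEnvelope W μ x ≤ k.q * ‖x - z₀‖ ^ 2 :=
  (moreauEnvelope_le_self h.nonneg hμ x).trans (h.apply_le x)

theorem sq_norm_le_envelope (h : IsProximalLyapunov k W F z₀) (hμ : 0 < μ) (x : E) :
    ‖x - z₀‖ ^ 2 ≤ k.comparison μ * moreauEnvelope W μ x := by
  have hp := k.p_pos
  rw [← div_le_iff₀' (k.comparison_pos hμ)]
  refine le_ciInf fun y => (div_le_iff₀' (k.comparison_pos hμ)).2 ?_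
  have hgap : k.comparison μ * (k.p * ‖y - z₀‖ ^ 2 + ‖x - y‖ ^ 2 / (2 * μ))
      - (‖x - y‖ + ‖y - z₀‖) ^ 2 = (‖x - y‖ - 2 * μ * k.p * ‖y - z₀‖) ^ 2 / (2 * μ * k.p) := by
    unfold DescentConstants.comparison
    field_simp
    ring
  calc ‖x - z₀‖ ^ 2 ≤ (‖x - y‖ + ‖y - z₀‖) ^ 2 := by
        gcongr
        exact norm_sub_le_norm_sub_add_norm_sub x y z₀
    _ ≤ k.comparison μ * (k.p * ‖y - z₀‖ ^ 2 + ‖x - y‖ ^ 2 / (2 * μ)) := by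
        rw [← sub_nonneg, hgap]
        positivity
    _ ≤ k.comparison μ * (W y + ‖x - y‖ ^ 2 / (2 * μ)) := by
        gcongr
        exacts [(k.comparison_pos hμ).le, h.le_apply y]

theorem sq_norm_prox_le_envelope (h : IsProximalLyapunov k W F z₀) (hμ : 0 < μ)
    (hy : IsProx W μ x y) : k.p * ‖y - z₀‖ ^ 2 ≤ moreauEnvelope W μ x :=
  (h.le_apply y).trans (hy.apply_le_moreauEnvelope h.nonneg hμ)

theorem sq_norm_sub_prox_le_envelope (h : IsProximalLyapunov k W F z₀) (hμ : 0 < μ)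
    (hy : IsProx W μ x y) : ‖x - y‖ ^ 2 ≤ μ ^ 2 * k.curvature * moreauEnvelope W μ x := by
  have hp := k.p_pos
  calc ‖x - y‖ ^ 2 ≤ (μ * k.S * ‖y - z₀‖) ^ 2 := by
        gcongr
        exact h.norm_sub_prox_le hμ hy
    _ = μ ^ 2 * k.curvature * (k.p * ‖y - z₀‖ ^ 2) := by
        unfold DescentConstants.curvature
        field_simp
    _ ≤ μ ^ 2 * k.curvature * moreauEnvelope W μ x :=
        mul_le_mul_of_nonneg_left (h.sq_norm_prox_le_envelope hμ hy)
          (mul_nonneg (sq_nonneg μ) k.curvature_pos.le)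

theorem envelope_le_apply_prox (h : IsProximalLyapunov k W F z₀) (hμ : 0 < μ)
    (hy : IsProx W μ x y) :
    k.p / k.q / (1 + μ * k.S) ^ 2 * moreauEnvelope W μ x ≤ W y := by
  have hp := k.p_pos
  have hq := k.q_pos
  have hS := k.S_pos
  have hdist : ‖x - z₀‖ ≤ (1 + μ * k.S) * ‖y - z₀‖ := by
    linarith [norm_sub_le_norm_sub_add_norm_sub x y z₀, h.norm_sub_prox_le hμ hy]
  calc k.p / k.q / (1 + μ * k.S) ^ 2 * moreauEnvelope W μ x
      ≤ k.p / k.q / (1 + μ * k.S) ^ 2 * (k.q * ((1 + μ * k.S) * ‖y - z₀‖) ^ 2) := by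
        gcongr
        exact (h.envelope_le hμ x).trans (by gcongr)
    _ = k.p * ‖y - z₀‖ ^ 2 := by field_simp
    _ ≤ W y := h.le_apply y

theorem norm_prox_le (h : IsProximalLyapunov k W F z₀) (hμ : 0 < μ)
    (hsmall : k.IsSmallSmoothing μ) (hx : ‖x‖ ≤ k.r) (hy : IsProx W μ x y) : ‖y‖ ≤ k.ρ := by
  have hΛ := k.curvature_pos
  have hdist := h.norm_sub_stationary_le (hx.trans k.r_lt_ρ.le)
  have hsq : ‖x - y‖ ^ 2 ≤ (k.ρ - k.r) ^ 2 := by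
    refine (h.sq_norm_sub_prox_le_envelope hμ hy).trans (le_trans ?_ hsmall)
    gcongr
    exact (h.envelope_le hμ x).trans (mul_le_mul_of_nonneg_left (by gcongr) k.q_pos.le)
  have hxy := abs_le_of_sq_le_sq hsq (sub_nonneg.2 k.r_lt_ρ.le)
  rw [abs_norm] at hxy
  linarith [norm_le_norm_add_norm_sub x y]

theorem envelope_le_of_le [FiniteDimensional ℝ E] (h : IsProximalLyapunov k W F z₀) {μ' : ℝ}
    (hμ' : 0 < μ') (hle : μ' ≤ μ) (x : E) : moreauEnvelope W μ' x
      ≤ (1 + k.curvature / 2 * μ * (μ / μ' - 1)) * moreauEnvelope W μ x := by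
  have hμ : 0 < μ := hμ'.trans_le hle
  obtain ⟨y, hy⟩ := exists_isProx h.continuous h.nonneg hμ x
  have hgap : 0 ≤ (μ / μ' - 1) / (2 * μ) :=
    div_nonneg (sub_nonneg.2 ((one_le_div hμ').2 hle)) (by positivity)
  calc moreauEnvelope W μ' x ≤ W y + ‖x - y‖ ^ 2 / (2 * μ') := moreauEnvelope_le h.nonneg hμ' x y
    _ = moreauEnvelope W μ x + (μ / μ' - 1) / (2 * μ) * ‖x - y‖ ^ 2 := by
        rw [hy.moreauEnvelope_eq h.nonneg hμ]
        field_simp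
        ring
    _ ≤ moreauEnvelope W μ x
          + (μ / μ' - 1) / (2 * μ) * (μ ^ 2 * k.curvature * moreauEnvelope W μ x) := by
        gcongr
        exact h.sq_norm_sub_prox_le_envelope hμ hy
    _ = (1 + k.curvature / 2 * μ * (μ / μ' - 1)) * moreauEnvelope W μ x := by
        field_simp

theorem inner_drift_le (h : IsProximalLyapunov k W F z₀) (hμ : 0 < μ) (hxρ : ‖x‖ ≤ k.ρ)
    (hyρ : ‖y‖ ≤ k.ρ) (hy : IsProx W μ x y) :
    inner ℝ (x - y) (F x) / μ
      ≤ -(k.β * W y ^ k.D) + k.L * μ * k.curvature * moreauEnvelope W μ x := by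
  have hL := k.L_pos
  rw [div_le_iff₀' hμ]
  calc inner ℝ (x - y) (F x) = inner ℝ (x - y) (F y) + inner ℝ (x - y) (F x - F y) := by
        rw [← inner_add_right, add_sub_cancel]
    _ ≤ -(μ * (k.β * W y ^ k.D)) + ‖x - y‖ * (k.L * ‖x - y‖) :=
        add_le_add (h.inner_prox_le hμ hy hyρ) ((real_inner_le_norm _ _).trans
          (mul_le_mul_of_nonneg_left (h.lipschitz x y hxρ hyρ) (norm_nonneg _)))
    _ = -(μ * (k.β * W y ^ k.D)) + k.L * ‖x - y‖ ^ 2 := by ring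
    _ ≤ -(μ * (k.β * W y ^ k.D)) + k.L * (μ ^ 2 * k.curvature * moreauEnvelope W μ x) := by
        gcongr
        exact h.sq_norm_sub_prox_le_envelope hμ hy
    _ = μ * (-(k.β * W y ^ k.D) + k.L * μ * k.curvature * moreauEnvelope W μ x) := by ring

theorem envelope_drift_le [FiniteDimensional ℝ E] (h : IsProximalLyapunov k W F z₀) {α : ℝ}
    (hμ : 0 < μ) (hα : 0 < α) (hsmall : k.IsSmallSmoothing μ) (hx : ‖x‖ ≤ k.r) :
    moreauEnvelope W μ (x + α • F x) ≤ moreauEnvelope W μ x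
      - α * (k.β * (k.p / k.q / (1 + μ * k.S) ^ 2 * moreauEnvelope W μ x) ^ k.D)
      + (α * k.L * μ * k.curvature + α ^ 2 * k.L ^ 2 * k.comparison μ / (2 * μ))
          * moreauEnvelope W μ x := by
  obtain ⟨y, hy⟩ := exists_isProx h.continuous h.nonneg hμ x
  have hxρ := hx.trans k.r_lt_ρ.le
  have hM := h.envelope_nonneg hμ x
  have hp := k.p_pos
  have hq := k.q_pos
  have hβ := k.β_pos
  have hinner := h.inner_drift_le hμ hxρ (h.norm_prox_le hμ hsmall hx hy) hy
  have hdecay : (k.p / k.q / (1 + μ * k.S) ^ 2 * moreauEnvelope W μ x) ^ k.D ≤ W y ^ k.D :=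
    Real.rpow_le_rpow (by positivity) (h.envelope_le_apply_prox hμ hy) k.D_pos.le
  have hdrift : ‖F x‖ ^ 2 ≤ k.L ^ 2 * (k.comparison μ * moreauEnvelope W μ x) := by
    refine (pow_le_pow_left₀ (norm_nonneg _) (h.norm_drift_le hxρ) 2).trans ?_
    rw [mul_pow]
    exact mul_le_mul_of_nonneg_left (h.sq_norm_le_envelope hμ x) (sq_nonneg _)
  refine (hy.moreauEnvelope_add_le h.nonneg hμ (α • F x)).trans ?_
  rw [real_inner_smul_right, norm_smul, mul_pow, Real.norm_of_nonneg hα.le, mul_div_assoc]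
  calc moreauEnvelope W μ x + α * (inner ℝ (x - y) (F x) / μ) + α ^ 2 * ‖F x‖ ^ 2 / (2 * μ)
      ≤ moreauEnvelope W μ x
        + α * (-(k.β * (k.p / k.q / (1 + μ * k.S) ^ 2 * moreauEnvelope W μ x) ^ k.D)
            + k.L * μ * k.curvature * moreauEnvelope W μ x)
        + α ^ 2 * (k.L ^ 2 * (k.comparison μ * moreauEnvelope W μ x)) / (2 * μ) := by
        gcongr
        exact hinner.trans (by gcongr)
    _ = _ := by ring

end IsProximalLyapunov

end ProximalLyapunov

section System

/-! ### Powers of the Lyapunov function -/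

theorem rpow_le_rpow_add_rpow {b x b' : ℝ} (hb : 0 < b) (hx : b ≤ x) (hx' : x ≤ b') (e : ℝ) :
    x ^ e ≤ b ^ e + b' ^ e := by
  have hx0 := hb.trans_le hx
  rcases le_total 0 e with he | he
  · exact (Real.rpow_le_rpow hx0.le hx' he).trans (le_add_of_nonneg_left (by positivity))
  · exact (Real.rpow_le_rpow_of_nonpos hb hx he).trans
      (le_add_of_nonneg_right (Real.rpow_nonneg (hx0.le.trans hx') e))

theorem mul_rpow_rpow_two_div {a b t : ℝ} (ha : a ≠ 0) (hb : 0 ≤ b) (ht : 0 ≤ t) :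
    (b * t ^ a) ^ (2 / a) = b ^ (2 / a) * t ^ 2 := by
  rw [Real.mul_rpow hb (by positivity), ← Real.rpow_mul ht, mul_div_cancel₀ _ ha, Real.rpow_two]

/-- A bound for the subgradients of `V ^ (2 / a)`, relative to the distance to the equilibrium. The
two powers cover both signs of the exponent `2 / a - 1`. -/
noncomputable def slopeBound (a C₁ C₂ G : ℝ) : ℝ :=
  2 / a * G * (C₁ ^ (2 / a - 1) + C₂ ^ (2 / a - 1))

theorem one_le_dac {a c : ℝ} (ha : 0 ≤ a) (hc : 1 ≤ c) : 1 ≤ dac a c :=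
  le_add_of_nonneg_left (div_nonneg (mul_nonneg ha (sub_nonneg.2 hc)) zero_le_two)

/-- The constants of the descent argument for `W = V ^ (2 / a)`. -/
noncomputable def descentConstants (a c γ C C₁ C₂ G A B s r ρ : ℝ) (ha : 0 < a) (hc : 1 ≤ c)
    (hγ : 0 < γ) (hC : 0 < C) (hC₁ : 0 < C₁) (hC₂ : 0 < C₂) (hG : 0 < G) (hB : 0 ≤ B)
    (hAB : 0 < A + 2 * B * s ^ 2) (hr : r < ρ) (hs : s ≤ ρ) : DescentConstants where
  p := C₁ ^ (2 / a)
  q := C₂ ^ (2 / a)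
  S := slopeBound a C₁ C₂ G
  β := 2 * γ / a
  D := dac a c
  L := C
  A := A
  B := B
  s := s
  r := r
  ρ := ρ
  p_pos := by positivity
  q_pos := by positivity
  S_pos := by unfold slopeBound; positivity
  β_pos := by positivity
  one_le_D := one_le_dac ha.le hc
  L_pos := hC
  B_nonneg := hB
  noise_pos := hAB
  s_le_ρ := hs
  r_lt_ρ := hr

namespace SystemAssumptions

variable {m : ℕ} {V : EuclideanSpace ℝ (Fin m) → ℝ}
  {F : EuclideanSpace ℝ (Fin m) → EuclideanSpace ℝ (Fin m)} {xs x y : EuclideanSpace ℝ (Fin m)}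
  {a c γ C C₁ C₂ G ρ μ : ℝ}

theorem nonneg (h : SystemAssumptions V F xs a c γ C C₁ C₂ G ρ) (hC₁ : 0 ≤ C₁)
    (z : EuclideanSpace ℝ (Fin m)) : 0 ≤ V z :=
  le_trans (by positivity) (h.growth z).1

theorem pos (h : SystemAssumptions V F xs a c γ C C₁ C₂ G ρ) (hC₁ : 0 < C₁) (hy : y ≠ xs) :
    0 < V y := by
  have := norm_pos_iff.2 (sub_ne_zero.2 hy)
  exact lt_of_lt_of_le (by positivity) (h.growth y).1

theorem apply_stationary (h : SystemAssumptions V F xs a c γ C C₁ C₂ G ρ) (ha : a ≠ 0) :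
    V xs = 0 := by
  have := h.growth xs
  simp only [sub_self, norm_zero, Real.zero_rpow ha, mul_zero] at this
  exact le_antisymm this.2 this.1

theorem le_rpow (h : SystemAssumptions V F xs a c γ C C₁ C₂ G ρ) (ha : 0 < a) (hC₁ : 0 ≤ C₁)
    (z : EuclideanSpace ℝ (Fin m)) : C₁ ^ (2 / a) * ‖z - xs‖ ^ 2 ≤ V z ^ (2 / a) := by
  rw [← mul_rpow_rpow_two_div ha.ne' hC₁ (norm_nonneg _)]
  exact Real.rpow_le_rpow (by positivity) (h.growth z).1 (by positivity)

theorem rpow_le (h : SystemAssumptions V F xs a c γ C C₁ C₂ G ρ) (ha : 0 < a) (hC₁ : 0 ≤ C₁)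
    (hC₂ : 0 ≤ C₂) (z : EuclideanSpace ℝ (Fin m)) :
    V z ^ (2 / a) ≤ C₂ ^ (2 / a) * ‖z - xs‖ ^ 2 := by
  rw [← mul_rpow_rpow_two_div ha.ne' hC₂ (norm_nonneg _)]
  exact Real.rpow_le_rpow (h.nonneg hC₁ z) (h.growth z).2 (by positivity)

theorem exists_mem_clarkeGradient (h : SystemAssumptions V F xs a c γ C C₁ C₂ G ρ) (ha : 0 < a)
    (hC₁ : 0 < C₁) (hx : IsProx (fun z => V z ^ (2 / a)) μ x y) (hy : y ≠ xs) :
    ∃ g ∈ clarkeGradient V y, μ⁻¹ • (x - y) = (2 / a * V y ^ (2 / a - 1)) • g :=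
  hx.exists_mem_clarkeGradient h.locallyLipschitz (h.nonneg hC₁.le) (by positivity) (h.pos hC₁ hy)

theorem norm_sub_prox_le (h : SystemAssumptions V F xs a c γ C C₁ C₂ G ρ) (ha : 0 < a)
    (hC₁ : 0 < C₁) (hC₂ : 0 ≤ C₂) (hμ : 0 < μ)
    (hx : IsProx (fun z => V z ^ (2 / a)) μ x y) :
    ‖x - y‖ ≤ μ * slopeBound a C₁ C₂ G * ‖y - xs‖ := by
  rcases eq_or_ne y xs with rfl | hy
  · simp [hx.eq_of_le_sq hμ (Real.rpow_nonneg (h.nonneg hC₁.le _) _) (h.rpow_le ha hC₁.le hC₂)]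
  obtain ⟨g, hg, hgrad⟩ := h.exists_mem_clarkeGradient ha hC₁ hx hy
  have hVy := h.pos hC₁ hy
  have ht : 0 < ‖y - xs‖ := norm_pos_iff.2 (sub_ne_zero.2 hy)
  set t := ‖y - xs‖
  have hpow : ∀ b : ℝ, 0 ≤ b → (b * t ^ a) ^ (2 / a - 1) = b ^ (2 / a - 1) * t ^ (2 - a) :=
    fun b hb => by
      rw [Real.mul_rpow hb (by positivity), ← Real.rpow_mul ht.le, mul_sub,
        mul_div_cancel₀ _ ha.ne', mul_one]
  have hV : V y ^ (2 / a - 1) ≤ (C₁ ^ (2 / a - 1) + C₂ ^ (2 / a - 1)) * t ^ (2 - a) := by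
    rw [add_mul, ← hpow C₁ hC₁.le, ← hpow C₂ hC₂]
    exact rpow_le_rpow_add_rpow (by positivity) (h.growth y).1 (h.growth y).2 _
  have hnorm : ‖x - y‖ = μ * (2 / a * V y ^ (2 / a - 1) * ‖g‖) := by
    have := congrArg norm hgrad
    rwa [norm_smul, norm_smul, Real.norm_of_nonneg (by positivity),
      Real.norm_of_nonneg (by positivity), inv_mul_eq_iff_eq_mul₀ hμ.ne'] at this
  calc ‖x - y‖ ≤ μ * (2 / a * ((C₁ ^ (2 / a - 1) + C₂ ^ (2 / a - 1)) * t ^ (2 - a))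
          * (G * t ^ (a - 1))) := by
        rw [hnorm]
        gcongr
        exact h.gradientGrowth y g hg
    _ = μ * slopeBound a C₁ C₂ G * (t ^ (2 - a) * t ^ (a - 1)) := by
        unfold slopeBound
        ring
    _ = μ * slopeBound a C₁ C₂ G * t := by
        rw [← Real.rpow_add ht, sub_add_sub_cancel, show (2 : ℝ) - 1 = 1 by norm_num,
          Real.rpow_one]

theorem inner_prox_le (h : SystemAssumptions V F xs a c γ C C₁ C₂ G ρ) (ha : 0 < a) (hc : 1 ≤ c)
    (hC₁ : 0 < C₁) (hμ : 0 < μ) (hx : IsProx (fun z => V z ^ (2 / a)) μ x y) (hy : ‖y‖ ≤ ρ) :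
    inner ℝ (x - y) (F y) ≤ -(μ * (2 * γ / a * (V y ^ (2 / a)) ^ dac a c)) := by
  rcases eq_or_ne y xs with rfl | hys
  · have hD := one_pos.trans_le (one_le_dac ha.le hc)
    rw [h.stationary, inner_zero_right, h.apply_stationary ha.ne', Real.zero_rpow (by positivity),
      Real.zero_rpow hD.ne', mul_zero, mul_zero, neg_zero]
  obtain ⟨g, hg, hgrad⟩ := h.exists_mem_clarkeGradient ha hC₁ hx hys
  have hVy := h.pos hC₁ hys
  rw [inv_smul_eq_iff₀ hμ.ne'] at hgrad
  calc inner ℝ (x - y) (F y) = μ * (2 / a * V y ^ (2 / a - 1) * inner ℝ g (F y)) := by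
        rw [hgrad, real_inner_smul_left, real_inner_smul_left]
    _ ≤ μ * (2 / a * V y ^ (2 / a - 1) * (-γ * V y ^ c)) := by
        gcongr
        exact h.stability y hy g hg
    _ = -(μ * (2 * γ / a * (V y ^ (2 / a - 1) * V y ^ c))) := by ring
    _ = -(μ * (2 * γ / a * (V y ^ (2 / a)) ^ dac a c)) := by
        rw [← Real.rpow_add hVy, ← Real.rpow_mul hVy.le, show 2 / a - 1 + c = 2 / a * dac a c by
          unfold dac; field_simp; ring]

theorem isProximalLyapunov (h : SystemAssumptions V F xs a c γ C C₁ C₂ G ρ) {A B r : ℝ}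
    (ha : 0 < a) (hc : 1 ≤ c) (hγ : 0 < γ) (hC : 0 < C) (hC₁ : 0 < C₁) (hC₂ : 0 < C₂) (hG : 0 < G)
    (hB : 0 ≤ B) (hAB : 0 < A + 2 * B * ‖xs‖ ^ 2) (hr : r < ρ) (hxs : ‖xs‖ ≤ ρ) :
    IsProximalLyapunov
      (descentConstants a c γ C C₁ C₂ G A B ‖xs‖ r ρ ha hc hγ hC hC₁ hC₂ hG hB hAB hr hxs)
      (fun z => V z ^ (2 / a)) F xs where
  continuous := h.locallyLipschitz.continuous.rpow_const fun _ => Or.inr (by positivity)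
  le_apply := h.le_rpow ha hC₁.le
  apply_le := h.rpow_le ha hC₁.le hC₂.le
  norm_sub_prox_le := h.norm_sub_prox_le ha hC₁ hC₂.le
  inner_prox_le := h.inner_prox_le ha hc hC₁
  norm_stationary := rfl
  stationary := h.stationary
  lipschitz := h.lipschitz

end SystemAssumptions

end System

section Noise

/-! ### Conditionally centred noise -/

variable {Ω E : Type*} {mΩ : MeasurableSpace Ω} {P : Measure Ω}

section Convexity

variable [NormedAddCommGroup E] [InnerProductSpace ℝ E] {m : MeasurableSpace Ω} {Z N : Ω → E}

theorem integrable_inner_of_memLp_two (hZ : MemLp Z 2 P) (hN : MemLp N 2 P) :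
    Integrable (fun ω => (inner ℝ (Z ω) (N ω) : ℝ)) P :=
  (hZ.norm.integrable_mul hN.norm).mono (hZ.1.inner hN.1)
    (ae_of_all _ fun _ => (norm_inner_le_norm _ _).trans (le_abs_self _))

variable [CompleteSpace E]

theorem integral_comp_le_integral_comp_add [IsFiniteMeasure P] {g : E → ℝ}
    (hg : ConvexOn ℝ Set.univ g) (hgc : Continuous g) (hm : m ≤ mΩ) (hZ : StronglyMeasurable[m] Z)
    (hZi : Integrable Z P) (hN : Integrable N P) (hN0 : P[N | m] =ᵐ[P] 0)
    (hgZ : Integrable (fun ω => g (Z ω)) P) (hgZN : Integrable (fun ω => g (Z ω + N ω)) P) :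
    ∫ ω, g (Z ω) ∂P ≤ ∫ ω, g (Z ω + N ω) ∂P := by
  have hcond : P[Z + N | m] =ᵐ[P] Z := by
    filter_upwards [condExp_add hZi hN m, hN0] with ω hadd h0
    rw [hadd, Pi.add_apply, h0, condExp_of_stronglyMeasurable hm hZ hZi, Pi.zero_apply, add_zero]
  rw [← integral_condExp hm (f := fun ω => g (Z ω + N ω))]
  refine integral_mono_ae hgZ integrable_condExp ?_
  filter_upwards [hg.map_condExp_le_univ hm hgc.lowerSemicontinuous (hZi.add hN) hgZN, hcond]
    with ω hjensen hω
  rw [← hω]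
  exact hjensen

theorem integral_inner_eq_zero [IsFiniteMeasure P] (hm : m ≤ mΩ) (hZ : StronglyMeasurable[m] Z)
    (hZ2 : MemLp Z 2 P) (hN : MemLp N 2 P) (hN0 : P[N | m] =ᵐ[P] 0) :
    ∫ ω, inner ℝ (Z ω) (N ω) ∂P = 0 := by
  have hcond := condExp_bilin_of_stronglyMeasurable_left (innerSL ℝ) hZ
    (integrable_inner_of_memLp_two hZ2 hN) (hN.integrable one_le_two)
  rw [← integral_condExp hm, integral_eq_zero_of_ae]
  filter_upwards [hcond, hN0] with ω hω h0
  refine hω.trans ?_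
  rw [h0, Pi.zero_apply, map_zero, Pi.zero_apply]

theorem integral_sq_norm_add [IsFiniteMeasure P] (hm : m ≤ mΩ) (hZ : StronglyMeasurable[m] Z)
    (hZ2 : MemLp Z 2 P) (hN : MemLp N 2 P) (hN0 : P[N | m] =ᵐ[P] 0) :
    ∫ ω, ‖Z ω + N ω‖ ^ 2 ∂P = ∫ ω, ‖Z ω‖ ^ 2 ∂P + ∫ ω, ‖N ω‖ ^ 2 ∂P := by
  have hcross := (integrable_inner_of_memLp_two hZ2 hN).const_mul 2
  have hZsq := hZ2.integrable_norm_pow two_ne_zero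
  have hleft : Integrable (fun ω => ‖Z ω‖ ^ 2 + 2 * inner ℝ (Z ω) (N ω)) P := hZsq.add hcross
  simp only [norm_add_sq_real]
  rw [integral_add hleft (hN.integrable_norm_pow two_ne_zero),
    integral_add hZsq hcross, integral_const_mul, integral_inner_eq_zero hm hZ hZ2 hN hN0, mul_zero,
    add_zero]

theorem integral_comp_add_le_of_convexOn_sub [IsFiniteMeasure P] {f : E → ℝ} {μ : ℝ}
    (hf : ConvexOn ℝ Set.univ fun z => ‖z‖ ^ 2 / (2 * μ) - f z) (hfc : Continuous f)
    (hm : m ≤ mΩ) (hZ : StronglyMeasurable[m] Z) (hZ2 : MemLp Z 2 P) (hN : MemLp N 2 P)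
    (hN0 : P[N | m] =ᵐ[P] 0) (hfZ : Integrable (fun ω => f (Z ω)) P)
    (hfZN : Integrable (fun ω => f (Z ω + N ω)) P) :
    ∫ ω, f (Z ω + N ω) ∂P ≤ ∫ ω, f (Z ω) ∂P + (∫ ω, ‖N ω‖ ^ 2 ∂P) / (2 * μ) := by
  have hZsq := (hZ2.integrable_norm_pow two_ne_zero).div_const (2 * μ)
  have hZNsq := ((hZ2.add hN).integrable_norm_pow two_ne_zero).div_const (2 * μ)
  simp only [Pi.add_apply] at hZNsq
  have hjensen := integral_comp_le_integral_comp_add hf (by fun_prop) hm hZ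
    (hZ2.integrable one_le_two) (hN.integrable one_le_two) hN0 (hZsq.sub hfZ) (hZNsq.sub hfZN)
  rw [integral_sub hZsq hfZ, integral_sub hZNsq hfZN, integral_div, integral_div,
    integral_sq_norm_add hm hZ hZ2 hN hN0, add_div] at hjensen
  linarith

end Convexity

theorem integrable_comp_of_norm_le [NormedAddCommGroup E] [ProperSpace E] [IsFiniteMeasure P]
    {g : E → ℝ} (hg : Continuous g) {X : Ω → E} (hX : AEStronglyMeasurable X P) {R : ℝ}
    (hR : ∀ᵐ ω ∂P, ‖X ω‖ ≤ R) : Integrable (fun ω => g (X ω)) P := by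
  obtain ⟨b, hb⟩ := (isCompact_closedBall (0 : E) R).exists_bound_of_continuousOn hg.continuousOn
  refine .of_bound (hg.comp_aestronglyMeasurable hX) b ?_
  filter_upwards [hR] with ω hω
  exact hb _ (mem_closedBall_zero_iff.2 hω)

theorem measurable_history {m : ℕ} (x w : ℕ → Ω → EuclideanSpace ℝ (Fin m)) (i : ℕ) :
    Measurable[history x w i] (x i) := by
  rw [measurable_iff_comap_le]
  exact le_sup_of_le_left (le_iSup₂_of_le i (Set.mem_Iic.2 le_rfl) le_rfl)

namespace IsTrajectory

variable {m : ℕ} {F : EuclideanSpace ℝ (Fin m) → EuclideanSpace ℝ (Fin m)} {step : ℕ → ℝ}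
  {A B r : ℝ} {x w : ℕ → Ω → EuclideanSpace ℝ (Fin m)}

theorem history_le (hT : IsTrajectory P F step A B r x w) (i : ℕ) : history x w i ≤ mΩ :=
  sup_le (iSup₂_le fun j _ => (hT.measurable_x j).comap_le)
    (iSup₂_le fun j _ => (hT.measurable_w j).comap_le)

theorem integrable_comp [IsFiniteMeasure P] (hT : IsTrajectory P F step A B r x w)
    {g : EuclideanSpace ℝ (Fin m) → ℝ} (hg : Continuous g) (i : ℕ) :
    Integrable (fun ω => g (x i ω)) P :=
  integrable_comp_of_norm_le hg (hT.measurable_x i).aestronglyMeasurable (hT.bounded i)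

theorem integrable_sq_norm_sub [IsFiniteMeasure P] (hT : IsTrajectory P F step A B r x w)
    (z : EuclideanSpace ℝ (Fin m)) (i : ℕ) : Integrable (fun ω => ‖x i ω - z‖ ^ 2) P :=
  hT.integrable_comp (g := fun y => ‖y - z‖ ^ 2) (by fun_prop) i

theorem integrable_sq_norm [IsFiniteMeasure P] (hT : IsTrajectory P F step A B r x w) (i : ℕ) :
    Integrable (fun ω => ‖x i ω‖ ^ 2) P :=
  hT.integrable_comp (g := fun y => ‖y‖ ^ 2) (by fun_prop) i

theorem integral_sq_norm_le [IsProbabilityMeasure P] (hT : IsTrajectory P F step A B r x w)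
    (z : EuclideanSpace ℝ (Fin m)) (i : ℕ) :
    ∫ ω, ‖x i ω‖ ^ 2 ∂P ≤ 2 * ‖z‖ ^ 2 + 2 * mse P x z i := by
  have hsq := (hT.integrable_sq_norm_sub z i).const_mul 2
  calc ∫ ω, ‖x i ω‖ ^ 2 ∂P ≤ ∫ ω, (2 * ‖z‖ ^ 2 + 2 * ‖x i ω - z‖ ^ 2) ∂P :=
        integral_mono (hT.integrable_sq_norm i) ((integrable_const _).add hsq) fun ω => by
          have := pow_le_pow_left₀ (norm_nonneg _) (norm_add_le z (x i ω - z)) 2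
          rw [add_sub_cancel] at this
          exact this.trans (add_sq_le.trans (mul_add _ _ _).le)
    _ = 2 * ‖z‖ ^ 2 + 2 * mse P x z i := by
        rw [integral_add (integrable_const _) hsq, integral_const, probReal_univ, one_smul,
          integral_const_mul, mse]

theorem integral_sq_noise_le [IsProbabilityMeasure P] (hT : IsTrajectory P F step A B r x w)
    (i : ℕ) : ∫ ω, ‖w i ω‖ ^ 2 ∂P ≤ A + B * ∫ ω, ‖x i ω‖ ^ 2 ∂P := by
  have hsq := (hT.integrable_sq_norm i).const_mul B
  calc ∫ ω, ‖w i ω‖ ^ 2 ∂P = ∫ ω, P[fun ω => ‖w i ω‖ ^ 2 | history x w i] ω ∂P :=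
        (integral_condExp (hT.history_le i)).symm
    _ ≤ ∫ ω, (A + B * ‖x i ω‖ ^ 2) ∂P :=
        integral_mono_ae integrable_condExp ((integrable_const A).add hsq) (hT.variance i)
    _ = A + B * ∫ ω, ‖x i ω‖ ^ 2 ∂P := by
        rw [integral_add (integrable_const A) hsq, integral_const, probReal_univ, one_smul,
          integral_const_mul]

-- The drift need not be measurable outside the ball, so it is cut off there.
theorem exists_stronglyMeasurable_drift (hT : IsTrajectory P F step A B r x w)
    (hF : ContinuousOn F (Metric.closedBall 0 r)) (i : ℕ) :
    ∃ Z : Ω → EuclideanSpace ℝ (Fin m), StronglyMeasurable[history x w i] Z ∧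
      (Z =ᵐ[P] fun ω => x i ω + step i • F (x i ω)) ∧ ∃ R, ∀ᵐ ω ∂P, ‖Z ω‖ ≤ R := by
  classical
  obtain ⟨b, hb⟩ := (isCompact_closedBall (0 : EuclideanSpace ℝ (Fin m)) r)
    |>.exists_bound_of_continuousOn hF
  have hcut : Measurable ((Metric.closedBall 0 r).piecewise F 0) :=
    hF.measurable_piecewise continuousOn_const Metric.isClosed_closedBall.measurableSet
  have hx := measurable_history x w i
  have heq : (fun ω => x i ω + step i • (Metric.closedBall 0 r).piecewise F 0 (x i ω))
      =ᵐ[P] fun ω => x i ω + step i • F (x i ω) := by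
    filter_upwards [hT.bounded i] with ω hω
    rw [Set.piecewise_eq_of_mem _ _ _ (mem_closedBall_zero_iff.2 hω)]
  refine ⟨_, (hx.add ((hcut.comp hx).const_smul (step i))).stronglyMeasurable, heq,
    r + |step i| * b, ?_⟩
  filter_upwards [heq, hT.bounded i] with ω hω hr
  refine (congrArg norm hω).trans_le ((norm_add_le _ _).trans (add_le_add hr ?_))
  rw [norm_smul, Real.norm_eq_abs]
  gcongr
  exact hb _ (mem_closedBall_zero_iff.2 hr)

theorem integral_comp_succ_le [IsProbabilityMeasure P] (hT : IsTrajectory P F step A B r x w)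
    (hF : ContinuousOn F (Metric.closedBall 0 r)) {f U : EuclideanSpace ℝ (Fin m) → ℝ} {μ : ℝ}
    (hμ : 0 < μ) (hf : ConvexOn ℝ Set.univ fun z => ‖z‖ ^ 2 / (2 * μ) - f z) (hfc : Continuous f)
    (hU : Continuous U) {i : ℕ} (hdrift : ∀ z, ‖z‖ ≤ r → f (z + step i • F z) ≤ U z) :
    ∫ ω, f (x (i + 1) ω) ∂P ≤ ∫ ω, U (x i ω) ∂P
      + step i ^ 2 / (2 * μ) * (A + B * ∫ ω, ‖x i ω‖ ^ 2 ∂P) := by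
  obtain ⟨Z, hZm, hZ, R, hR⟩ := hT.exists_stronglyMeasurable_drift hF i
  have hZm' := (hZm.mono (hT.history_le i)).aestronglyMeasurable (μ := P)
  have hupdate : x (i + 1) =ᵐ[P] fun ω => Z ω + step i • w i ω := by
    filter_upwards [hT.update i, hZ] with ω hx hω
    rw [hx, hω, smul_add, add_assoc]
  have hfZ : Integrable (fun ω => f (Z ω)) P := integrable_comp_of_norm_le hfc hZm' hR
  have hfZU : ∫ ω, f (Z ω) ∂P ≤ ∫ ω, U (x i ω) ∂P := by
    refine integral_mono_ae hfZ (hT.integrable_comp hU i) ?_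
    filter_upwards [hZ, hT.bounded i] with ω hω hr
    exact (congrArg f hω).trans_le (hdrift _ hr)
  have hnoise : ∫ ω, ‖step i • w i ω‖ ^ 2 ∂P ≤ step i ^ 2 * (A + B * ∫ ω, ‖x i ω‖ ^ 2 ∂P) := by
    simp only [norm_smul, mul_pow, Real.norm_eq_abs, sq_abs]
    rw [integral_const_mul]
    exact mul_le_mul_of_nonneg_left (hT.integral_sq_noise_le i) (sq_nonneg _)
  have hcentred : P[step i • w i | history x w i] =ᵐ[P] 0 := by
    filter_upwards [condExp_smul (step i) (w i) (history x w i), hT.unbiased i] with ω hsmul h0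
    rw [hsmul, Pi.smul_apply, h0, Pi.zero_apply, smul_zero]
  have hfZN : Integrable (fun ω => f (Z ω + step i • w i ω)) P :=
    (hT.integrable_comp hfc (i + 1)).congr (hupdate.fun_comp f)
  have hstep := integral_comp_add_le_of_convexOn_sub hf hfc (hT.history_le i) hZm
    (.of_bound hZm' R hR) ((hT.memLp_w i).const_smul (step i)) hcentred hfZ hfZN
  calc ∫ ω, f (x (i + 1) ω) ∂P = ∫ ω, f (Z ω + step i • w i ω) ∂P :=
        integral_congr_ae (hupdate.fun_comp f)
    _ ≤ ∫ ω, f (Z ω) ∂P + (∫ ω, ‖step i • w i ω‖ ^ 2 ∂P) / (2 * μ) := hstep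
    _ ≤ ∫ ω, U (x i ω) ∂P + step i ^ 2 * (A + B * ∫ ω, ‖x i ω‖ ^ 2 ∂P) / (2 * μ) := by
        gcongr
    _ = _ := by rw [mul_div_right_comm]

end IsTrajectory

end Noise

section Contraction

/-! ### One step of the mean envelope -/

/-- The rate at which one step of size `α` contracts the mean envelope, up to a factor: `ν` is the
coefficient of the decay `s ↦ ν s ^ D` along the drift, and `α² n` is the level of the noise. -/
noncomputable def stepRate (D α ν n : ℝ) : ℝ :=
  1 / 2 * D * α ^ (2 - 1 / D) * ν ^ (1 / D) * n ^ (1 - 1 / D)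

theorem stepRate_pos {D α ν n : ℝ} (hD : 0 < D) (hα : 0 < α) (hν : 0 < ν) (hn : 0 < n) :
    0 < stepRate D α ν n := by
  unfold stepRate
  positivity

theorem tangent_le_rpow {D s ε : ℝ} (hD : 1 ≤ D) (hs : 0 ≤ s) (hε : 0 < ε) :
    D * ε ^ (D - 1) * s - (D - 1) * ε ^ D ≤ s ^ D := by
  have hbernoulli := one_add_mul_self_le_rpow_one_add (s := s / ε - 1) (p := D)
    (by linarith [div_nonneg hs hε.le]) hD
  rw [add_sub_cancel, Real.div_rpow hs hε.le, le_div_iff₀ (by positivity)] at hbernoulli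
  refine le_of_eq_of_le ?_ hbernoulli
  rw [Real.rpow_sub hε, Real.rpow_one]
  field_simp
  ring

-- The tangent is taken at the point where the decay balances the noise.
theorem stepRate_mul_le {D α ν n s : ℝ} (hD : 1 ≤ D) (hα : 0 < α) (hν : 0 < ν) (hn : 0 < n)
    (hs : 0 ≤ s) :
    2 * stepRate D α ν n * s - (D - 1) * α ^ 2 * n ≤ α * (ν * s ^ D) := by
  have hD0 : D ≠ 0 := by linarith
  have hb : 0 < α * n / ν := by positivity
  have htangent := tangent_le_rpow hD hs (Real.rpow_pos_of_pos hb (1 / D))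
  rw [← Real.rpow_mul hb.le, ← Real.rpow_mul hb.le, one_div_mul_cancel hD0, Real.rpow_one,
    show 1 / D * (D - 1) = 1 - 1 / D by field_simp] at htangent
  have hslope : α * ν * (α * n / ν) ^ (1 - 1 / D)
      = α ^ (2 - 1 / D) * ν ^ (1 / D) * n ^ (1 - 1 / D) := by
    rw [Real.div_rpow (by positivity) hν.le, Real.mul_rpow hα.le hn.le,
      show 2 - 1 / D = 1 + (1 - 1 / D) by ring, Real.rpow_add hα, Real.rpow_one,
      Real.rpow_sub hν 1 (1 / D), Real.rpow_one]
    have : 0 < ν ^ (1 / D) := by positivity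
    field_simp
  calc 2 * stepRate D α ν n * s - (D - 1) * α ^ 2 * n
      = D * (α * ν * (α * n / ν) ^ (1 - 1 / D)) * s - (D - 1) * α ^ 2 * n := by
        rw [hslope, stepRate]
        ring
    _ = α * ν * (D * (α * n / ν) ^ (1 - 1 / D) * s - (D - 1) * (α * n / ν)) := by
        field_simp
    _ ≤ α * ν * s ^ D := by gcongr
    _ = α * (ν * s ^ D) := mul_assoc _ _ _

/-- The relations between a step size `α`, a smoothing parameter `μ`, a decay coefficient `ν` and a
noise level `n` under which one step contracts the mean envelope at rate `stepRate k.D α ν n`. -/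
structure StepCondition (k : DescentConstants) (α μ ν n : ℝ) : Prop where
  step_pos : 0 < α
  smoothing_pos : 0 < μ
  decay_pos : 0 < ν
  smoothing : k.IsSmallSmoothing μ
  decay : ν ≤ k.β * (k.p / k.q) ^ k.D
  distortion : ((1 + μ * k.S) ^ 2) ^ k.D ≤ 4 / 3
  error : α * k.L * μ * k.curvature + α ^ 2 * (k.L ^ 2 + 2 * k.B) * k.comparison μ / (2 * μ)
    ≤ stepRate k.D α ν n / 4
  noise : (k.A + 2 * k.B * k.s ^ 2) / (2 * μ) ≤ n

namespace StepCondition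

variable {k : DescentConstants} {α μ ν n : ℝ}

theorem noise_pos (h : StepCondition k α μ ν n) : 0 < n :=
  (div_pos k.noise_pos (mul_pos two_pos h.smoothing_pos)).trans_le h.noise

theorem decay_mul_le (h : StepCondition k α μ ν n) {t : ℝ} (ht : 0 ≤ t) :
    3 / 4 * (ν * t ^ k.D) ≤ k.β * (k.p / k.q / (1 + μ * k.S) ^ 2 * t) ^ k.D := by
  have hp := k.p_pos
  have hq := k.q_pos
  have hS := k.S_pos
  have hβ := k.β_pos
  have hμ := h.smoothing_pos
  have hsplit : (k.p / k.q / (1 + μ * k.S) ^ 2 * t) ^ k.D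
      = (k.p / k.q) ^ k.D * t ^ k.D / ((1 + μ * k.S) ^ 2) ^ k.D := by
    rw [div_mul_eq_mul_div, Real.div_rpow (by positivity) (by positivity),
      Real.mul_rpow (by positivity) ht]
  rw [hsplit, mul_div_assoc', le_div_iff₀ (by positivity)]
  calc 3 / 4 * (ν * t ^ k.D) * ((1 + μ * k.S) ^ 2) ^ k.D
      ≤ 3 / 4 * (k.β * (k.p / k.q) ^ k.D * t ^ k.D) * (4 / 3) := by
        gcongr
        exacts [h.decay, h.distortion]
    _ = k.β * ((k.p / k.q) ^ k.D * t ^ k.D) := by ring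

theorem envelope_drift_le {E : Type*} [NormedAddCommGroup E] [InnerProductSpace ℝ E]
    [FiniteDimensional ℝ E] {W : E → ℝ} {F : E → E} {z₀ x : E} (h : StepCondition k α μ ν n)
    (hW : IsProximalLyapunov k W F z₀) (hx : ‖x‖ ≤ k.r) :
    moreauEnvelope W μ (x + α • F x) ≤ (1 - 3 / 2 * stepRate k.D α ν n
      + (α * k.L * μ * k.curvature + α ^ 2 * k.L ^ 2 * k.comparison μ / (2 * μ)))
        * moreauEnvelope W μ x + 3 / 4 * ((k.D - 1) * α ^ 2 * n) := by
  have hM := hW.envelope_nonneg h.smoothing_pos x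
  have hdrift := hW.envelope_drift_le h.smoothing_pos h.step_pos h.smoothing hx
  have hdecay := mul_le_mul_of_nonneg_left (h.decay_mul_le hM) h.step_pos.le
  have hrate := stepRate_mul_le k.one_le_D h.step_pos h.decay_pos h.noise_pos hM
  linarith

end StepCondition

namespace IsProximalLyapunov

variable {m : ℕ} {Ω : Type*} {mΩ : MeasurableSpace Ω} {P : Measure Ω} {k : DescentConstants}
  {W : EuclideanSpace ℝ (Fin m) → ℝ} {F : EuclideanSpace ℝ (Fin m) → EuclideanSpace ℝ (Fin m)}
  {z₀ : EuclideanSpace ℝ (Fin m)} {step : ℕ → ℝ} {x w : ℕ → Ω → EuclideanSpace ℝ (Fin m)} {μ : ℝ}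

theorem continuousOn_drift (h : IsProximalLyapunov k W F z₀) :
    ContinuousOn F (Metric.closedBall 0 k.r) := by
  have hlip : LipschitzOnWith ⟨k.L, k.L_pos.le⟩ F (Metric.closedBall 0 k.ρ) :=
    .of_dist_le_mul fun y hy z hz => by
      rw [dist_eq_norm, dist_eq_norm]
      exact h.lipschitz y z (mem_closedBall_zero_iff.1 hy) (mem_closedBall_zero_iff.1 hz)
  exact hlip.continuousOn.mono (Metric.closedBall_subset_closedBall k.r_lt_ρ.le)

theorem integrable_envelope [IsFiniteMeasure P] (h : IsProximalLyapunov k W F z₀)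
    (hT : IsTrajectory P F step k.A k.B k.r x w) (hμ : 0 < μ) (i : ℕ) :
    Integrable (fun ω => moreauEnvelope W μ (x i ω)) P :=
  hT.integrable_comp (continuous_moreauEnvelope h.continuous h.nonneg hμ) i

theorem mse_le [IsFiniteMeasure P] (h : IsProximalLyapunov k W F z₀)
    (hT : IsTrajectory P F step k.A k.B k.r x w) (hμ : 0 < μ) (i : ℕ) :
    mse P x z₀ i ≤ k.comparison μ * ∫ ω, moreauEnvelope W μ (x i ω) ∂P := by
  rw [← integral_const_mul]
  exact integral_mono (hT.integrable_sq_norm_sub z₀ i)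
    ((h.integrable_envelope hT hμ i).const_mul _) fun ω => h.sq_norm_le_envelope hμ _

theorem integral_envelope_le_mse [IsFiniteMeasure P] (h : IsProximalLyapunov k W F z₀)
    (hT : IsTrajectory P F step k.A k.B k.r x w) (hμ : 0 < μ) (i : ℕ) :
    ∫ ω, moreauEnvelope W μ (x i ω) ∂P ≤ mse P x z₀ i * k.q := by
  rw [mul_comm, mse, ← integral_const_mul]
  exact integral_mono (h.integrable_envelope hT hμ i)
    ((hT.integrable_sq_norm_sub z₀ i).const_mul _) fun ω => h.envelope_le hμ _

theorem integral_envelope_le_of_le [IsFiniteMeasure P] (h : IsProximalLyapunov k W F z₀)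
    (hT : IsTrajectory P F step k.A k.B k.r x w) {μ' : ℝ} (hμ' : 0 < μ') (hle : μ' ≤ μ) (i : ℕ) :
    ∫ ω, moreauEnvelope W μ' (x i ω) ∂P ≤ (1 + k.curvature / 2 * μ * (μ / μ' - 1)) *
      ∫ ω, moreauEnvelope W μ (x i ω) ∂P := by
  rw [← integral_const_mul]
  exact integral_mono (h.integrable_envelope hT hμ' i)
    ((h.integrable_envelope hT (hμ'.trans_le hle) i).const_mul _)
    fun ω => h.envelope_le_of_le hμ' hle _

theorem integral_envelope_succ_le [IsProbabilityMeasure P] (h : IsProximalLyapunov k W F z₀)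
    (hT : IsTrajectory P F step k.A k.B k.r x w) {i : ℕ} {ν n : ℝ}
    (hstep : StepCondition k (step i) μ ν n) :
    ∫ ω, moreauEnvelope W μ (x (i + 1) ω) ∂P
      ≤ (1 - 5 / 4 * stepRate k.D (step i) ν n) * ∫ ω, moreauEnvelope W μ (x i ω) ∂P
        + k.D * step i ^ 2 * n := by
  have hμ := hstep.smoothing_pos
  have hM := h.integrable_envelope hT hμ i
  have hMc := continuous_moreauEnvelope h.continuous h.nonneg hμ
  have hmean := hT.integral_comp_succ_le h.continuousOn_drift hμ
    (convexOn_sub_moreauEnvelope h.continuous h.nonneg hμ) hMc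
    (by fun_prop) (i := i) fun z hz => hstep.envelope_drift_le h hz
  rw [integral_add (hM.const_mul _) (integrable_const _), integral_const_mul, integral_const,
    probReal_univ, one_smul] at hmean
  set I := ∫ ω, moreauEnvelope W μ (x i ω) ∂P
  have hI : 0 ≤ I := integral_nonneg fun ω => h.envelope_nonneg hμ _
  have hvariance : step i ^ 2 / (2 * μ) * (k.A + k.B * ∫ ω, ‖x i ω‖ ^ 2 ∂P)
      ≤ step i ^ 2 / (2 * μ) * (k.A + k.B * (2 * k.s ^ 2 + 2 * (k.comparison μ * I))) := by
    have hsecond := hT.integral_sq_norm_le z₀ i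
    rw [h.norm_stationary] at hsecond
    gcongr
    · exact k.B_nonneg
    · exact hsecond.trans (by gcongr; exact h.mse_le hT hμ i)
  have herror := mul_le_mul_of_nonneg_right hstep.error hI
  have hnoise := mul_le_mul_of_nonneg_left hstep.noise (sq_nonneg (step i))
  have hconvex : 0 ≤ (k.D - 1) * step i ^ 2 * n :=
    mul_nonneg (mul_nonneg (sub_nonneg.2 k.one_le_D) (sq_nonneg _)) hstep.noise_pos.le
  have hsplit : step i ^ 2 / (2 * μ) * (k.A + k.B * (2 * k.s ^ 2 + 2 * (k.comparison μ * I)))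
      = step i ^ 2 * ((k.A + 2 * k.B * k.s ^ 2) / (2 * μ))
        + step i ^ 2 * (2 * k.B) * k.comparison μ / (2 * μ) * I := by ring
  have herror_split : step i ^ 2 * (k.L ^ 2 + 2 * k.B) * k.comparison μ / (2 * μ)
      = step i ^ 2 * k.L ^ 2 * k.comparison μ / (2 * μ)
        + step i ^ 2 * (2 * k.B) * k.comparison μ / (2 * μ) := by ring
  rw [herror_split] at herror
  linarith

end IsProximalLyapunov

end Contraction

section Recursions

/-! ### Scalar recursions -/

variable {n s φ ω d q K : ℝ} {u : ℕ → ℝ}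

theorem log_add_one_div_le (hn : 0 < n) : Real.log ((n + 1) / n) ≤ 1 / n := by
  refine (Real.log_le_sub_one_of_pos (by positivity)).trans_eq ?_
  rw [add_div, div_self hn.ne', add_sub_cancel_left]

theorem one_div_add_one_le_log (hn : 0 < n) : 1 / (n + 1) ≤ Real.log ((n + 1) / n) := by
  refine le_of_eq_of_le ?_ (Real.one_sub_inv_le_log_of_pos (by positivity))
  field_simp
  ring

theorem one_add_div_le_rpow (hn : 0 < n) (hs : 0 ≤ s) : 1 + s / (n + 1) ≤ ((n + 1) / n) ^ s := by
  rw [Real.rpow_def_of_pos (by positivity), add_comm]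
  refine (Real.add_one_le_exp _).trans (Real.exp_le_exp.2 ?_)
  rw [div_eq_mul_one_div, mul_comm]
  exact mul_le_mul_of_nonneg_right (one_div_add_one_le_log hn) hs

theorem one_sub_div_le_rpow (hn : 0 < n) (hs : 0 ≤ s) : 1 - s / n ≤ (n / (n + 1)) ^ s := by
  rw [← inv_div (n + 1) n, Real.inv_rpow (by positivity), ← Real.rpow_neg (by positivity),
    Real.rpow_def_of_pos (by positivity), sub_eq_neg_add]
  refine (Real.add_one_le_exp _).trans (Real.exp_le_exp.2 ?_)
  rw [mul_neg, neg_le_neg_iff, div_eq_mul_one_div s, mul_comm]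
  exact mul_le_mul_of_nonneg_left (log_add_one_div_le hn) hs

theorem add_one_div_rpow_le_exp_one (hn : 0 < n) (hs : 0 ≤ s) (hsn : s ≤ n) :
    ((n + 1) / n) ^ s ≤ Real.exp 1 := by
  rw [Real.rpow_def_of_pos (by positivity), Real.exp_le_exp]
  calc Real.log ((n + 1) / n) * s ≤ 1 / n * s := by gcongr; exact log_add_one_div_le hn
    _ ≤ 1 := by rwa [one_div_mul_eq_div, div_le_one hn]

theorem rpow_add_one_sub_rpow_le (hn : 0 < n) (hq : 0 ≤ q) (hq1 : q ≤ 1) :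
    (n + 1) ^ q - n ^ q ≤ q * n ^ (q - 1) := by
  have hbernoulli := rpow_one_add_le_one_add_mul_self (s := 1 / n)
    (by linarith [one_div_pos.2 hn]) hq hq1
  calc (n + 1) ^ q - n ^ q = n ^ q * (1 + 1 / n) ^ q - n ^ q := by
        rw [← Real.mul_rpow hn.le (by positivity), mul_add, mul_one_div_cancel hn.ne', mul_one]
    _ ≤ n ^ q * (1 + q * (1 / n)) - n ^ q := by gcongr
    _ = q * n ^ (q - 1) := by
        rw [Real.rpow_sub_one hn.ne']
        ring

theorem le_of_constant_recursion (hφ : 0 < φ) (hφ1 : φ ≤ 1) (hω : 0 ≤ ω)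
    (hu : ∀ k, u (k + 1) ≤ (1 - φ) * u k + ω) (k : ℕ) :
    u k ≤ u 0 * (1 - φ) ^ k + ω / φ := by
  induction k with
  | zero =>
    rw [pow_zero, mul_one]
    exact le_add_of_nonneg_right (by positivity)
  | succ k ih =>
    calc u (k + 1) ≤ (1 - φ) * (u 0 * (1 - φ) ^ k + ω / φ) + ω :=
          (hu k).trans (by gcongr)
      _ = u 0 * (1 - φ) ^ (k + 1) + ω / φ := by
          rw [pow_succ]
          field_simp
          ring

theorem one_sub_div_rpow_mul_exp_le (hn : 0 < n) (hφ : 0 ≤ φ) (hq : 0 ≤ q) (hq1 : q < 1) :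
    (1 - φ / n ^ q) * Real.exp (-(φ * (n ^ (1 - q) - K ^ (1 - q)) / (1 - q)))
      ≤ Real.exp (-(φ * ((n + 1) ^ (1 - q) - K ^ (1 - q)) / (1 - q))) := by
  have hq' := sub_pos.2 hq1
  have hincr := rpow_add_one_sub_rpow_le hn hq'.le (by linarith)
  rw [show 1 - q - 1 = -q by ring, Real.rpow_neg hn.le, ← div_eq_mul_inv] at hincr
  calc (1 - φ / n ^ q) * Real.exp (-(φ * (n ^ (1 - q) - K ^ (1 - q)) / (1 - q)))
      ≤ Real.exp (-(φ / n ^ q)) * Real.exp (-(φ * (n ^ (1 - q) - K ^ (1 - q)) / (1 - q))) := by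
        gcongr
        linarith [Real.add_one_le_exp (-(φ / n ^ q))]
    _ = Real.exp (-(φ / (1 - q) * ((1 - q) / n ^ q)
          + φ * (n ^ (1 - q) - K ^ (1 - q)) / (1 - q))) := by
        rw [← Real.exp_add, div_mul_div_cancel₀ hq'.ne', neg_add]
    _ ≤ Real.exp (-(φ / (1 - q) * ((n + 1) ^ (1 - q) - n ^ (1 - q))
          + φ * (n ^ (1 - q) - K ^ (1 - q)) / (1 - q))) := by
        gcongr
    _ = Real.exp (-(φ * ((n + 1) ^ (1 - q) - K ^ (1 - q)) / (1 - q))) := by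
        congr 1
        ring

theorem one_sub_div_rpow_mul_add_le (hn : 0 < n) (hφ : 0 < φ) (hω : 0 ≤ ω) (hs : 0 ≤ s)
    (hsn : 2 * s ≤ φ * n ^ (1 - q)) :
    (1 - φ / n ^ q) * (2 * ω / (φ * n ^ s)) + ω / n ^ (q + s) ≤ 2 * ω / (φ * (n + 1) ^ s) := by
  have hrate : s / n ≤ φ / (2 * n ^ q) := by
    rw [Real.rpow_sub hn, Real.rpow_one, ← mul_div_assoc, le_div_iff₀ (by positivity)] at hsn
    rw [div_le_div_iff₀ hn (by positivity)]
    linarith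
  calc (1 - φ / n ^ q) * (2 * ω / (φ * n ^ s)) + ω / n ^ (q + s)
      = 2 * ω / (φ * n ^ s) * (1 - φ / (2 * n ^ q)) := by
        rw [Real.rpow_add hn]
        field_simp
        ring
    _ ≤ 2 * ω / (φ * n ^ s) * (n / (n + 1)) ^ s := by
        gcongr
        exact (sub_le_sub_left hrate 1).trans (one_sub_div_le_rpow hn hs)
    _ = 2 * ω / (φ * (n + 1) ^ s) := by
        rw [Real.div_rpow hn.le (by positivity)]
        field_simp

theorem le_of_subharmonic_recursion (hK : 0 < K) (hq : 0 ≤ q) (hq1 : q < 1) (hs : 0 ≤ s)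
    (hφ : 0 < φ) (hω : 0 ≤ ω) (hu0 : 0 ≤ u 0) (hφK : ∀ k : ℕ, φ / (k + K) ^ q ≤ 1)
    (hsK : ∀ k : ℕ, 2 * s ≤ φ * (k + K) ^ (1 - q))
    (hu : ∀ k : ℕ, u (k + 1) ≤ (1 - φ / (k + K) ^ q) * u k + ω / (k + K) ^ (q + s)) (k : ℕ) :
    u k ≤ u 0 * Real.exp (-(φ * ((k + K) ^ (1 - q) - K ^ (1 - q)) / (1 - q)))
      + 2 * ω / (φ * (k + K) ^ s) := by
  induction k with
  | zero =>
    rw [Nat.cast_zero, zero_add, sub_self, mul_zero, zero_div, neg_zero, Real.exp_zero, mul_one]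
    exact le_add_of_nonneg_right (by positivity)
  | succ k ih =>
    have hn : 0 < (k : ℝ) + K := by positivity
    rw [show ((k + 1 : ℕ) : ℝ) + K = k + K + 1 by push_cast; ring]
    refine (hu k).trans ((add_le_add_left
      (mul_le_mul_of_nonneg_left ih (sub_nonneg.2 (hφK k))) _).trans ?_)
    rw [mul_add, mul_left_comm, add_assoc]
    exact add_le_add
      (mul_le_mul_of_nonneg_left (one_sub_div_rpow_mul_exp_le hn hφ.le hq hq1) hu0)
      (one_sub_div_rpow_mul_add_le hn hφ hω hs (hsK k))

theorem rpow_add_one_mul_le (hn : 1 ≤ n) (hφ : 0 ≤ φ) (hω : 0 ≤ ω) (hd : 0 ≤ d) {v v' : ℝ}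
    (hv : 0 ≤ v) (hv' : v' ≤ (1 - φ / n) * v + ω / n ^ d) :
    (n + 1) ^ φ * v' ≤ n ^ φ * v + 2 ^ d * ω * (n + 1) ^ (φ - d) := by
  have hn0 := one_pos.trans_le hn
  calc (n + 1) ^ φ * v' ≤ (n + 1) ^ φ * ((n / (n + 1)) ^ φ * v + ω * (2 / (n + 1)) ^ d) := by
        refine mul_le_mul_of_nonneg_left (hv'.trans (add_le_add ?_ ?_)) (by positivity)
        · exact mul_le_mul_of_nonneg_right (one_sub_div_le_rpow hn0 hφ) hv
        · rw [div_eq_mul_inv, ← Real.inv_rpow hn0.le]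
          gcongr
          rw [inv_eq_one_div, div_le_div_iff₀ hn0 (by positivity)]
          linarith
    _ = n ^ φ * v + 2 ^ d * ω * (n + 1) ^ (φ - d) := by
        rw [Real.div_rpow hn0.le (by positivity), Real.div_rpow zero_le_two (by positivity),
          Real.rpow_sub (by positivity)]
        field_simp

theorem le_of_harmonic_recursion (hK : 1 ≤ K) (hφ : 0 ≤ φ) (hω : 0 ≤ ω) (hd : 0 ≤ d)
    (hu0 : ∀ k, 0 ≤ u k) (hu : ∀ k : ℕ, u (k + 1) ≤ (1 - φ / (k + K)) * u k + ω / (k + K) ^ d)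
    {Q : ℕ → ℝ} (hQ : ∀ k : ℕ, ((k : ℝ) + K + 1) ^ (φ - d) ≤ Q (k + 1) - Q k) {R : ℝ} {k : ℕ}
    (hR : Q k - Q 0 ≤ R) :
    u k ≤ u 0 * (K / (k + K)) ^ φ + 1 / (k + K) ^ φ * (2 ^ d * ω * R) := by
  have hK0 := one_pos.trans_le hK
  have hweighted : ∀ k : ℕ, (k + K) ^ φ * u k ≤ K ^ φ * u 0 + 2 ^ d * ω * (Q k - Q 0) := by
    intro k
    induction k with
    | zero => simp
    | succ k ih =>
      have hstep := rpow_add_one_mul_le (le_add_of_nonneg_of_le k.cast_nonneg hK) hφ hω hd (hu0 k)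
        (hu k)
      have hQk := mul_le_mul_of_nonneg_left (hQ k) (by positivity : 0 ≤ 2 ^ d * ω)
      rw [show ((k + 1 : ℕ) : ℝ) + K = k + K + 1 by push_cast; ring]
      linarith
  have hn : 0 < (k : ℝ) + K := by positivity
  calc u k = 1 / (k + K) ^ φ * ((k + K) ^ φ * u k) := by field_simp
    _ ≤ 1 / (k + K) ^ φ * (K ^ φ * u 0 + 2 ^ d * ω * R) := by
        gcongr
        exact (hweighted k).trans (by gcongr)
    _ = u 0 * (K / (k + K)) ^ φ + 1 / (k + K) ^ φ * (2 ^ d * ω * R) := by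
        rw [Real.div_rpow hK0.le hn.le]
        ring

theorem le_of_harmonic_recursion_of_lt (hK : 1 ≤ K) (hφ : 0 ≤ φ) (hω : 0 ≤ ω)
    (hu0 : ∀ k, 0 ≤ u k) (hu : ∀ k : ℕ, u (k + 1) ≤ (1 - φ / (k + K)) * u k + ω / (k + K) ^ d)
    (hlt : φ < d - 1) (k : ℕ) :
    u k ≤ u 0 * (K / (k + K)) ^ φ + 1 / (k + K) ^ φ * (2 ^ d * ω / (d - 1 - φ)) := by
  have hp := sub_pos.2 hlt
  have := one_pos.trans_le hK
  rw [div_eq_mul_one_div (2 ^ d * ω)]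
  refine le_of_harmonic_recursion hK hφ hω (by linarith) hu0 hu
    (Q := fun k => -((k + K) ^ (-(d - 1 - φ)) / (d - 1 - φ))) (fun k => ?_) ?_
  · have hn : 0 < (k : ℝ) + K := by positivity
    have hincr := one_add_div_le_rpow hn hp.le
    rw [show ((k + 1 : ℕ) : ℝ) + K = k + K + 1 by push_cast; ring, neg_sub_neg, ← sub_div,
      le_div_iff₀ hp, show φ - d = -(d - 1 - φ) - 1 by ring, Real.rpow_sub_one (by positivity)]
    rw [Real.div_rpow (by positivity) hn.le, le_div_iff₀ (by positivity)] at hincr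
    rw [Real.rpow_neg hn.le, Real.rpow_neg (by positivity)]
    field_simp
    field_simp at hincr
    linarith
  · have hKp : K ^ (-(d - 1 - φ)) ≤ 1 := Real.rpow_le_one_of_one_le_of_nonpos hK (by linarith)
    rw [neg_sub_neg, ← sub_div, Nat.cast_zero, zero_add]
    gcongr
    exact (sub_le_self _ (by positivity)).trans hKp

theorem le_of_harmonic_recursion_of_eq (hK : 1 ≤ K) (hω : 0 ≤ ω) (hd : 1 ≤ d)
    (hu0 : ∀ k, 0 ≤ u k)
    (hu : ∀ k : ℕ, u (k + 1) ≤ (1 - (d - 1) / (k + K)) * u k + ω / (k + K) ^ d) (k : ℕ) :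
    u k ≤ u 0 * (K / (k + K)) ^ (d - 1) + Real.log (k + K) / (k + K) ^ (d - 1) * (2 ^ d * ω) := by
  have := one_pos.trans_le hK
  rw [← one_div_mul_eq_div _ (Real.log _), mul_assoc, mul_comm (Real.log _)]
  refine le_of_harmonic_recursion hK (sub_nonneg.2 hd) hω (by linarith) hu0 hu
    (Q := fun k => Real.log (k + K)) (fun k => ?_) ?_
  · have hn : 0 < (k : ℝ) + K := by positivity
    rw [show ((k + 1 : ℕ) : ℝ) + K = k + K + 1 by push_cast; ring, sub_sub_cancel_left,
      Real.rpow_neg_one, inv_eq_one_div, ← Real.log_div (by positivity) hn.ne']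
    exact one_div_add_one_le_log hn
  · rw [Nat.cast_zero, zero_add]
    exact sub_le_self _ (Real.log_nonneg hK)

theorem le_of_harmonic_recursion_of_gt (hK : 1 ≤ K) (hω : 0 ≤ ω) (hd : 1 ≤ d)
    (hu0 : ∀ k, 0 ≤ u k) (hu : ∀ k : ℕ, u (k + 1) ≤ (1 - φ / (k + K)) * u k + ω / (k + K) ^ d)
    (hgt : d - 1 < φ) (hφK : φ - (d - 1) ≤ K) (k : ℕ) :
    u k ≤ u 0 * (K / (k + K)) ^ φ
      + 1 / (k + K) ^ (d - 1) * (Real.exp 1 * 2 ^ d * ω / (φ - (d - 1))) := by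
  have hq := sub_pos.2 hgt
  have := one_pos.trans_le hK
  have hbound := le_of_harmonic_recursion (k := k) hK (by linarith) hω (by linarith) hu0 hu
    (Q := fun i => Real.exp 1 * (i + K) ^ (φ - (d - 1)) / (φ - (d - 1))) (fun i => ?_)
    (sub_le_self _ (by positivity))
  · refine hbound.trans_eq ?_
    have hn : 0 < (k : ℝ) + K := by positivity
    rw [show φ = φ - (d - 1) + (d - 1) by ring]
    rw [Real.rpow_add hn]
    field_simp
    ring_nf
  · have hn : 0 < (i : ℝ) + K := by positivity
    have hexp := add_one_div_rpow_le_exp_one hn hq.le (le_add_of_nonneg_of_le i.cast_nonneg hφK)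
    have hincr := one_add_div_le_rpow hn hq.le
    rw [Real.div_rpow (by positivity) hn.le, div_le_iff₀ (by positivity)] at hexp
    rw [Real.div_rpow (by positivity) hn.le, le_div_iff₀ (by positivity), one_add_mul,
      ← le_sub_iff_add_le'] at hincr
    rw [show ((i + 1 : ℕ) : ℝ) + K = i + K + 1 by push_cast; ring,
      show φ - d = φ - (d - 1) - 1 by ring, Real.rpow_sub_one (by positivity), ← sub_div, ← mul_sub,
      le_div_iff₀ hq]
    set n := (i : ℝ) + K
    calc (n + 1) ^ (φ - (d - 1)) / (n + 1) * (φ - (d - 1))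
        ≤ Real.exp 1 * n ^ (φ - (d - 1)) / (n + 1) * (φ - (d - 1)) := by gcongr
      _ = Real.exp 1 * ((φ - (d - 1)) / (n + 1) * n ^ (φ - (d - 1))) := by ring
      _ ≤ Real.exp 1 * ((n + 1) ^ (φ - (d - 1)) - n ^ (φ - (d - 1))) := by gcongr

end Recursions

/-- A sequence `u` of nonnegative Lyapunov values controlling a sequence `E` of errors. -/
structure IsLyapunovSequence (E u : ℕ → ℝ) (q κ : ℝ) : Prop where
  nonneg : ∀ i, 0 ≤ u i
  zero_le : u 0 ≤ E 0 * q
  le : ∀ i, E i ≤ κ * u i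
  ratio_nonneg : 0 ≤ κ

theorem IsLyapunovSequence.le_of_le {E u : ℕ → ℝ} {q κ p e : ℝ} {i : ℕ}
    (h : IsLyapunovSequence E u q κ) (hp : 0 ≤ p) (hu : u i ≤ u 0 * p + e) :
    E i ≤ E 0 * q * κ * p + κ * e := by
  have hκ := h.ratio_nonneg
  calc E i ≤ κ * (u 0 * p + e) := (h.le i).trans (by gcongr)
    _ ≤ κ * (E 0 * q * p + e) := by gcongr; exact h.zero_le
    _ = E 0 * q * κ * p + κ * e := by ring

theorem IsProximalLyapunov.isLyapunovSequence {m : ℕ} {Ω : Type*} {mΩ : MeasurableSpace Ω}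
    {P : Measure Ω} [IsFiniteMeasure P] {k : DescentConstants}
    {W : EuclideanSpace ℝ (Fin m) → ℝ} {F : EuclideanSpace ℝ (Fin m) → EuclideanSpace ℝ (Fin m)}
    {z₀ : EuclideanSpace ℝ (Fin m)} {step μ : ℕ → ℝ} {x w : ℕ → Ω → EuclideanSpace ℝ (Fin m)}
    {μ₀ : ℝ} (h : IsProximalLyapunov k W F z₀) (hT : IsTrajectory P F step k.A k.B k.r x w)
    (hμ : ∀ i, 0 < μ i) (hμ₀ : ∀ i, μ i ≤ μ₀) :
    IsLyapunovSequence (mse P x z₀) (fun i => ∫ ω, moreauEnvelope W (μ i) (x i ω) ∂P) k.q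
      (k.comparison μ₀) where
  nonneg i := integral_nonneg fun ω => h.envelope_nonneg (hμ i) _
  zero_le := h.integral_envelope_le_mse hT (hμ 0) 0
  le i := by
    refine (h.mse_le hT (hμ i) i).trans (mul_le_mul_of_nonneg_right ?_
      (integral_nonneg fun ω => h.envelope_nonneg (hμ i) _))
    exact k.comparison_le_comparison (hμ₀ i)
  ratio_nonneg := (k.comparison_pos ((hμ 0).trans_le (hμ₀ 0))).le

section DiminishingSteps

/-! ### Diminishing steps -/

theorem stepRate_le_stepRate {D α ν ν' n n' : ℝ} (hD : 1 ≤ D) (hα : 0 ≤ α) (hν : 0 ≤ ν)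
    (hn : 0 ≤ n) (hνν' : ν ≤ ν') (hnn' : n ≤ n') : stepRate D α ν n ≤ stepRate D α ν' n' := by
  have hD' : 0 ≤ 1 - 1 / D := sub_nonneg.2 ((div_le_one (by positivity)).2 hD)
  have hν' := hν.trans hνν'
  unfold stepRate
  gcongr

/-- The exponent `ξ'` of the contraction rate when the steps decay with exponent `ξ` and the
smoothing parameters with exponent `ξ / 2`. -/
noncomputable def rateExponent (D ξ : ℝ) : ℝ := (3 * D - 1) * ξ / (2 * D)

variable {D ξ : ℝ}

theorem rateExponent_pos (hD : 1 ≤ D) (hξ : 0 < ξ) : 0 < rateExponent D ξ :=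
  div_pos (mul_pos (by linarith) hξ) (by positivity)

theorem rateExponent_add (hD : 0 < D) : rateExponent D ξ + ξ / (2 * D) = 3 * ξ / 2 := by
  unfold rateExponent
  field_simp
  ring

theorem le_rateExponent (hD : 1 ≤ D) (hξ : 0 ≤ ξ) : ξ ≤ rateExponent D ξ := by
  rw [rateExponent, le_div_iff₀ (by positivity)]
  nlinarith

theorem stepRate_div_rpow {α ν N n : ℝ} (hD : 0 < D) (hα : 0 ≤ α) (hN : 0 ≤ N) (hn : 0 < n) :
    stepRate D (α / n ^ ξ) ν (N * n ^ (ξ / 2)) = stepRate D α ν N / n ^ rateExponent D ξ := by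
  unfold stepRate
  rw [Real.div_rpow hα (by positivity), Real.mul_rpow hN (by positivity), ← Real.rpow_mul hn.le,
    ← Real.rpow_mul hn.le,
    show ξ * (2 - 1 / D) = rateExponent D ξ + ξ / 2 * (1 - 1 / D) by
      unfold rateExponent; field_simp; ring,
    Real.rpow_add hn]
  field_simp

theorem add_one_rpow_le {n s : ℝ} (hn : 0 < n) (hs : s ≤ 1) :
    (n + 1) ^ s ≤ n ^ s * (1 + 1 / n) := by
  rw [show n + 1 = n * (1 + 1 / n) by field_simp, Real.mul_rpow hn.le (by positivity)]
  gcongr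
  exact Real.rpow_le_self_of_one_le (le_add_of_nonneg_right (by positivity)) hs

/-- Steps `α / n ^ ξ` and smoothing parameters `μ / n ^ (ξ / 2)`, with a decay coefficient `ν` and a
coefficient `N` of the noise level `N n ^ (ξ / 2)` adapted to the constants `k`. -/
structure Schedule (k : DescentConstants) (α μ ξ ν N : ℝ) : Prop where
  step_pos : 0 < α
  smoothing_pos : 0 < μ
  exponent_pos : 0 < ξ
  rateExponent_le_one : rateExponent k.D ξ ≤ 1
  decay_pos : 0 < ν
  decay : ν ≤ k.β * (k.p / k.q) ^ k.D
  noise : (k.L ^ 2 + 1) * (k.A + 2 * k.B * k.s ^ 2) / (2 * μ) ≤ N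

/-- The coefficient of the error made by replacing the proximal point by the iterate, in steps
decaying as in `Schedule`. -/
noncomputable def errorCoeff (k : DescentConstants) (α μ : ℝ) : ℝ :=
  α * k.L * μ * k.curvature
    + α ^ 2 * (k.L ^ 2 + 2 * k.B) * k.comparison μ * (k.L ^ 2 + 1) / (2 * μ)

/-- The time `n` is so late that the steps of a `Schedule` contract at rate `φ / n ^ ξ'`. -/
structure IsLateTime (k : DescentConstants) (α μ ξ φ n : ℝ) : Prop where
  one_le : 1 ≤ n
  smoothing : k.IsSmallSmoothing (μ / n ^ (ξ / 2))
  distortion : ((1 + μ / n ^ (ξ / 2) * k.S) ^ 2) ^ k.D ≤ 4 / 3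
  one_div_le : 1 / n ≤ k.L ^ 2
  error : errorCoeff k α μ / n ^ (ξ / (2 * k.D)) ≤ φ / 4
  curvature : k.curvature / 2 * μ / n ^ (ξ / 2) ≤ φ / 4
  rate : φ / n ^ rateExponent k.D ξ ≤ 4 / 5
  rate_le : φ ≤ n
  exponent_le : rateExponent k.D ξ < 1 → 2 * (ξ / (2 * k.D)) ≤ φ * n ^ (1 - rateExponent k.D ξ)

namespace Schedule

variable {k : DescentConstants} {α μ ν N φ n : ℝ}

theorem noise_pos (h : Schedule k α μ ξ ν N) : 0 < N := by
  have := k.noise_pos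
  have := h.smoothing_pos
  exact lt_of_lt_of_le (by positivity) h.noise

theorem exponent_le_one (h : Schedule k α μ ξ ν N) : ξ ≤ 1 :=
  (le_rateExponent k.one_le_D h.exponent_pos.le).trans h.rateExponent_le_one

theorem add_one_rpow_le (h : Schedule k α μ ξ ν N) (hn : IsLateTime k α μ ξ φ n) :
    (n + 1) ^ (ξ / 2) ≤ n ^ (ξ / 2) * (k.L ^ 2 + 1) := by
  have hn0 := one_pos.trans_le hn.one_le
  refine (NonsmoothSA.add_one_rpow_le hn0 (by linarith [h.exponent_le_one])).trans ?_
  rw [add_comm 1]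
  gcongr
  exact hn.one_div_le

theorem error_le (h : Schedule k α μ ξ ν N) (hn : IsLateTime k α μ ξ φ n) :
    α / n ^ ξ * k.L * (μ / (n + 1) ^ (ξ / 2)) * k.curvature
        + (α / n ^ ξ) ^ 2 * (k.L ^ 2 + 2 * k.B) * k.comparison (μ / (n + 1) ^ (ξ / 2))
          / (2 * (μ / (n + 1) ^ (ξ / 2)))
      ≤ φ / n ^ rateExponent k.D ξ / 4 := by
  have hn0 := one_pos.trans_le hn.one_le
  have hα := h.step_pos
  have hμ := h.smoothing_pos
  have hξ := h.exponent_pos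
  have hΛ := k.curvature_pos
  have hκ := k.comparison_pos hμ
  have hL := k.L_pos
  have hB := k.B_nonneg
  have hgrowth := h.add_one_rpow_le hn
  have hstep : n ^ ξ = (n ^ (ξ / 2)) ^ 2 := by
    rw [← Real.rpow_mul_natCast hn0.le]
    ring_nf
  have hcube : n ^ rateExponent k.D ξ * n ^ (ξ / (2 * k.D)) = (n ^ (ξ / 2)) ^ 3 := by
    rw [← Real.rpow_add hn0, rateExponent_add k.D_pos, ← Real.rpow_mul_natCast hn0.le]
    push_cast
    ring_nf
  have hκ_le : k.comparison (μ / (n + 1) ^ (ξ / 2)) ≤ k.comparison μ :=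
    k.comparison_le_comparison
      (div_le_self hμ.le (Real.one_le_rpow (by linarith) (by positivity)))
  calc _ ≤ α / n ^ ξ * k.L * (μ / n ^ (ξ / 2)) * k.curvature
        + (α / n ^ ξ) ^ 2 * (k.L ^ 2 + 2 * k.B) * k.comparison μ
          / (2 * (μ / (n ^ (ξ / 2) * (k.L ^ 2 + 1)))) := by
        gcongr
        linarith
    _ = errorCoeff k α μ / n ^ (ξ / (2 * k.D)) / n ^ rateExponent k.D ξ := by
        rw [div_div, mul_comm (n ^ (ξ / (2 * k.D))), hcube, hstep, errorCoeff]
        field_simp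
    _ ≤ φ / 4 / n ^ rateExponent k.D ξ := by
        exact div_le_div_of_nonneg_right hn.error (by positivity)
    _ = φ / n ^ rateExponent k.D ξ / 4 := div_right_comm _ _ _

theorem stepCondition (h : Schedule k α μ ξ ν N)
    (hn : IsLateTime k α μ ξ (stepRate k.D α ν N) n) :
    StepCondition k (α / n ^ ξ) (μ / (n + 1) ^ (ξ / 2)) ν (N * n ^ (ξ / 2)) := by
  have hn0 := one_pos.trans_le hn.one_le
  have hα := h.step_pos
  have hμ := h.smoothing_pos
  have hξ := h.exponent_pos
  have hpos : 0 < μ / (n + 1) ^ (ξ / 2) := by positivity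
  have hle : μ / (n + 1) ^ (ξ / 2) ≤ μ / n ^ (ξ / 2) := by gcongr; linarith
  refine ⟨by positivity, hpos, h.decay_pos, hn.smoothing.mono hpos.le hle, h.decay,
    (k.distortion_le_distortion hpos.le hle).trans hn.distortion, ?_, ?_⟩
  · rw [stepRate_div_rpow k.D_pos hα.le h.noise_pos.le hn0]
    exact h.error_le hn
  · have hnoise := k.noise_pos
    calc (k.A + 2 * k.B * k.s ^ 2) / (2 * (μ / (n + 1) ^ (ξ / 2)))
        = (k.A + 2 * k.B * k.s ^ 2) / (2 * μ) * (n + 1) ^ (ξ / 2) := by field_simp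
      _ ≤ (k.A + 2 * k.B * k.s ^ 2) / (2 * μ) * (n ^ (ξ / 2) * (k.L ^ 2 + 1)) := by
          gcongr
          exact h.add_one_rpow_le hn
      _ = (k.L ^ 2 + 1) * (k.A + 2 * k.B * k.s ^ 2) / (2 * μ) * n ^ (ξ / 2) := by ring
      _ ≤ N * n ^ (ξ / 2) := by
          gcongr
          exact h.noise

theorem smoothing_change_le (h : Schedule k α μ ξ ν N) (hn : IsLateTime k α μ ξ φ n) :
    k.curvature / 2 * (μ / n ^ (ξ / 2)) * (μ / n ^ (ξ / 2) / (μ / (n + 1) ^ (ξ / 2)) - 1)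
      ≤ φ / n ^ rateExponent k.D ξ / 4 := by
  have hn0 := one_pos.trans_le hn.one_le
  have hμ := h.smoothing_pos
  have hΛ := k.curvature_pos
  have hratio : μ / n ^ (ξ / 2) / (μ / (n + 1) ^ (ξ / 2)) - 1 ≤ 1 / n ^ rateExponent k.D ξ := by
    calc μ / n ^ (ξ / 2) / (μ / (n + 1) ^ (ξ / 2)) - 1
        = (n + 1) ^ (ξ / 2) / n ^ (ξ / 2) - 1 := by field_simp
      _ ≤ 1 / n := by
          rw [sub_le_iff_le_add', div_le_iff₀' (by positivity)]
          exact NonsmoothSA.add_one_rpow_le hn0 (by linarith [h.exponent_le_one])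
      _ ≤ 1 / n ^ rateExponent k.D ξ := by
          gcongr
          exact Real.rpow_le_self_of_one_le hn.one_le h.rateExponent_le_one
  calc _ ≤ k.curvature / 2 * (μ / n ^ (ξ / 2)) * (1 / n ^ rateExponent k.D ξ) := by gcongr
    _ = k.curvature / 2 * μ / n ^ (ξ / 2) / n ^ rateExponent k.D ξ := by ring
    _ ≤ φ / 4 / n ^ rateExponent k.D ξ := by
        exact div_le_div_of_nonneg_right hn.curvature (by positivity)
    _ = φ / n ^ rateExponent k.D ξ / 4 := div_right_comm _ _ _

end Schedule

theorem eventually_isSmallSmoothing (k : DescentConstants) :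
    ∀ᶠ μ : ℝ in 𝓝 0, k.IsSmallSmoothing μ := by
  have hlim : Tendsto (fun μ : ℝ => μ ^ 2 * k.curvature * (k.q * (2 * k.ρ) ^ 2)) (𝓝 0) (𝓝 0) :=
    Continuous.tendsto' (by fun_prop) _ _ (by ring)
  exact hlim.eventually_le_const (pow_pos (sub_pos.2 k.r_lt_ρ) 2)

theorem eventually_distortion_le (k : DescentConstants) :
    ∀ᶠ μ : ℝ in 𝓝 0, ((1 + μ * k.S) ^ 2) ^ k.D ≤ 4 / 3 := by
  have hcont : Continuous fun μ : ℝ => ((1 + μ * k.S) ^ 2) ^ k.D :=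
    Continuous.rpow_const (by fun_prop) fun _ => Or.inr k.D_pos.le
  exact (hcont.tendsto' 0 1 (by simp)).eventually_le_const (by norm_num)

theorem tendsto_const_div_rpow_atTop {b : ℝ} (X : ℝ) (hb : 0 < b) :
    Tendsto (fun n : ℝ => X / n ^ b) atTop (𝓝 0) :=
  (tendsto_rpow_atTop hb).const_div_atTop X

variable {k : DescentConstants} {α μ ν N : ℝ}

theorem eventually_isLateTime {φ₁ φ₂ : ℝ} (hξ : 0 < ξ) (hφ₁ : 0 < φ₁) :
    ∀ᶠ n : ℝ in atTop, ∀ φ ∈ Set.Icc φ₁ φ₂, IsLateTime k α μ ξ φ n := by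
  have hD := k.D_pos
  have hξ' := rateExponent_pos k.one_le_D hξ
  have hsmoothing := tendsto_const_div_rpow_atTop μ (half_pos hξ)
  have hexponent : ∀ᶠ n : ℝ in atTop, rateExponent k.D ξ < 1 →
      2 * (ξ / (2 * k.D)) ≤ φ₁ * n ^ (1 - rateExponent k.D ξ) := by
    by_cases hlt : rateExponent k.D ξ < 1
    · filter_upwards [((tendsto_rpow_atTop (sub_pos.2 hlt)).const_mul_atTop
        hφ₁).eventually_ge_atTop (2 * (ξ / (2 * k.D)))] with n hn _ using hn
    · exact .of_forall fun n h => absurd h hlt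
  filter_upwards [eventually_ge_atTop 1, hsmoothing.eventually (eventually_isSmallSmoothing k),
    hsmoothing.eventually (eventually_distortion_le k),
    (tendsto_const_div_rpow_atTop 1 one_pos).eventually_le_const (pow_pos k.L_pos 2),
    (tendsto_const_div_rpow_atTop (errorCoeff k α μ)
      (div_pos hξ (mul_pos two_pos hD))).eventually_le_const
      (by positivity : 0 < φ₁ / 4),
    (tendsto_const_div_rpow_atTop (k.curvature / 2 * μ) (half_pos hξ)).eventually_le_const
      (by positivity : 0 < φ₁ / 4),
    (tendsto_const_div_rpow_atTop φ₂ hξ').eventually_le_const (by norm_num : (0 : ℝ) < 4 / 5),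
    eventually_ge_atTop φ₂, hexponent]
    with n hone hsmall hdistortion hdiv herror hcurvature hrate hle hexp φ ⟨hφ, hφ'⟩
  have hquarter : φ₁ / 4 ≤ φ / 4 := by gcongr
  exact ⟨hone, hsmall, hdistortion, by rwa [Real.rpow_one] at hdiv, herror.trans hquarter,
    hcurvature.trans hquarter, (by gcongr : _ ≤ _).trans hrate, hφ'.trans hle,
    fun h => (hexp h).trans (by gcongr)⟩

theorem exists_forall_isLateTime {φ : ℝ → ℝ} {φ₁ φ₂ : ℝ} (hξ : 0 < ξ) (hφ₁ : 0 < φ₁)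
    (hφ : ∀ K, 1 ≤ K → φ K ∈ Set.Icc φ₁ φ₂) :
    ∃ K₀ : ℝ, 1 ≤ K₀ ∧ ∀ K, K₀ ≤ K → ∀ n, K ≤ n → IsLateTime k α μ ξ (φ K) n := by
  obtain ⟨K₀, hK₀⟩ := eventually_atTop.1
    (eventually_isLateTime (k := k) (φ₂ := φ₂) hξ hφ₁)
  exact ⟨max 1 K₀, le_max_left _ _, fun K hK n hn =>
    hK₀ n ((le_max_right _ _).trans (hK.trans hn)) _ (hφ K ((le_max_left _ _).trans hK))⟩

namespace IsProximalLyapunov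

variable {m : ℕ} {Ω : Type*} {mΩ : MeasurableSpace Ω} {P : Measure Ω} [IsProbabilityMeasure P]
  {W : EuclideanSpace ℝ (Fin m) → ℝ} {F : EuclideanSpace ℝ (Fin m) → EuclideanSpace ℝ (Fin m)}
  {z₀ : EuclideanSpace ℝ (Fin m)} {x w : ℕ → Ω → EuclideanSpace ℝ (Fin m)} {K : ℝ}

theorem integral_envelope_diminishing {i : ℕ} (h : IsProximalLyapunov k W F z₀)
    (hS : Schedule k α μ ξ ν N)
    (hT : IsTrajectory P F (fun i => α / ((i : ℝ) + K) ^ ξ) k.A k.B k.r x w)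
    (hn : IsLateTime k α μ ξ (stepRate k.D α ν N) (i + K)) :
    ∫ ω, moreauEnvelope W (μ / ((i + 1 : ℕ) + K) ^ (ξ / 2)) (x (i + 1) ω) ∂P
      ≤ (1 - stepRate k.D α ν N / (i + K) ^ rateExponent k.D ξ)
          * ∫ ω, moreauEnvelope W (μ / (i + K) ^ (ξ / 2)) (x i ω) ∂P
        + k.D * α ^ 2 * N / (i + K) ^ (3 * ξ / 2) := by
  have hn0 := one_pos.trans_le hn.one_le
  have hstep := hS.stepCondition hn
  have hsucc := h.integral_envelope_succ_le hT hstep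
  have hsmoothing : μ / (i + K + 1) ^ (ξ / 2) ≤ μ / (i + K) ^ (ξ / 2) :=
    div_le_div_of_nonneg_left hS.smoothing_pos.le (by positivity)
      (Real.rpow_le_rpow hn0.le (by linarith) (half_pos hS.exponent_pos).le)
  have hchange := h.integral_envelope_le_of_le hT hstep.smoothing_pos hsmoothing i
  have hfactor := hS.smoothing_change_le hn
  have hI : 0 ≤ ∫ ω, moreauEnvelope W (μ / (i + K) ^ (ξ / 2)) (x i ω) ∂P :=
    integral_nonneg fun ω => h.envelope_nonneg (div_pos hS.smoothing_pos (by positivity)) _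
  have hrate := hn.rate
  rw [stepRate_div_rpow k.D_pos hS.step_pos.le hS.noise_pos.le hn0] at hsucc
  rw [show ((i + 1 : ℕ) : ℝ) + K = i + K + 1 by push_cast; ring]
  set n := (i : ℝ) + K
  set ψ := stepRate k.D α ν N / n ^ rateExponent k.D ξ
  set I := ∫ ω, moreauEnvelope W (μ / n ^ (ξ / 2)) (x i ω) ∂P
  have hnoise : k.D * (α / n ^ ξ) ^ 2 * (N * n ^ (ξ / 2)) = k.D * α ^ 2 * N / n ^ (3 * ξ / 2) := by
    rw [show 3 * ξ / 2 = ξ + ξ - ξ / 2 by ring, Real.rpow_sub hn0, Real.rpow_add hn0]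
    field_simp
  calc _ ≤ (1 - 5 / 4 * ψ) * ((1 + ψ / 4) * I) + k.D * α ^ 2 * N / n ^ (3 * ξ / 2) := by
        rw [← hnoise]
        refine hsucc.trans (add_le_add_left (mul_le_mul_of_nonneg_left
          (hchange.trans (by gcongr)) (by linarith)) _)
    _ ≤ (1 - ψ) * I + k.D * α ^ 2 * N / n ^ (3 * ξ / 2) := by
        gcongr ?_ + _
        linarith [mul_nonneg (sq_nonneg ψ) hI]

theorem exists_isLyapunovSequence_diminishing (h : IsProximalLyapunov k W F z₀)
    (hS : Schedule k α μ ξ ν N)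
    (hT : IsTrajectory P F (fun i => α / ((i : ℝ) + K) ^ ξ) k.A k.B k.r x w)
    (hK : ∀ n, K ≤ n → IsLateTime k α μ ξ (stepRate k.D α ν N) n) :
    ∃ u, IsLyapunovSequence (mse P x z₀) u k.q (k.comparison (μ / K ^ (ξ / 2))) ∧
      ∀ i : ℕ, u (i + 1) ≤ (1 - stepRate k.D α ν N / (i + K) ^ rateExponent k.D ξ) * u i
        + k.D * α ^ 2 * N / (i + K) ^ (3 * ξ / 2) := by
  have hK0 := one_pos.trans_le (hK K le_rfl).one_le
  have hμ := hS.smoothing_pos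
  have hle : ∀ i : ℕ, K ≤ i + K := fun i => le_add_of_nonneg_left i.cast_nonneg
  refine ⟨fun i => ∫ ω, moreauEnvelope W (μ / (i + K) ^ (ξ / 2)) (x i ω) ∂P,
    h.isLyapunovSequence hT (fun i => by positivity) fun i => ?_,
    fun i => h.integral_envelope_diminishing hS hT (hK _ (hle i))⟩
  exact div_le_div_of_nonneg_left hμ.le (by positivity)
    (Real.rpow_le_rpow hK0.le (hle i) (half_pos hS.exponent_pos).le)

theorem mse_le_of_rateExponent_eq_one {d : ℝ} (h : IsProximalLyapunov k W F z₀)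
    (hS : Schedule k α μ ξ ν N)
    (hT : IsTrajectory P F (fun i => α / ((i : ℝ) + K) ^ ξ) k.A k.B k.r x w)
    (hK : ∀ n, K ≤ n → IsLateTime k α μ ξ (stepRate k.D α ν N) n)
    (hξ : rateExponent k.D ξ = 1) (hd : 3 * ξ / 2 = d) (i : ℕ) :
    let φ := stepRate k.D α ν N
    let ω := k.D * α ^ 2 * N
    let κ := k.comparison (μ / K ^ (ξ / 2))
    let E := mse P x z₀
    (φ < d - 1 → E i ≤ E 0 * k.q * κ * (K / (i + K)) ^ φ
      + κ * (1 / (i + K) ^ φ * (2 ^ d * ω / (d - 1 - φ)))) ∧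
    (φ = d - 1 → E i ≤ E 0 * k.q * κ * (K / (i + K)) ^ φ
      + κ * (Real.log (i + K) / (i + K) ^ (d - 1) * (2 ^ d * ω))) ∧
    (d - 1 < φ → E i ≤ E 0 * k.q * κ * (K / (i + K)) ^ φ
      + κ * (1 / (i + K) ^ (d - 1) * (Real.exp 1 * 2 ^ d * ω / (φ - (d - 1))))) := by
  intro φ ω κ E
  obtain ⟨u, hu, hrec⟩ := h.exists_isLyapunovSequence_diminishing hS hT hK
  have hlate := hK K le_rfl
  have hK1 := hlate.one_le
  have hφ : 0 ≤ φ := (stepRate_pos k.D_pos hS.step_pos hS.decay_pos hS.noise_pos).le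
  have hω : 0 ≤ ω := mul_nonneg (mul_nonneg k.D_pos.le (sq_nonneg α)) hS.noise_pos.le
  have hd1 : 1 ≤ d := by
    rw [← hd, ← rateExponent_add k.D_pos, hξ]
    exact le_add_of_nonneg_right (div_nonneg hS.exponent_pos.le (by linarith [k.D_pos]))
  have hφK : φ ≤ K := hlate.rate_le
  simp only [hξ, Real.rpow_one, hd] at hrec
  have hp : 0 ≤ (K / (i + K)) ^ φ := by positivity
  refine ⟨fun hlt => hu.le_of_le hp ?_, fun heq => hu.le_of_le hp ?_, fun hgt => hu.le_of_le hp ?_⟩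
  · exact le_of_harmonic_recursion_of_lt hK1 hφ hω hu.nonneg hrec hlt i
  · rw [heq]
    exact le_of_harmonic_recursion_of_eq hK1 hω hd1 hu.nonneg (by simpa only [← heq] using hrec) i
  · exact le_of_harmonic_recursion_of_gt hK1 hω hd1 hu.nonneg hrec hgt (by linarith) i

theorem mse_le_of_rateExponent_lt_one (h : IsProximalLyapunov k W F z₀)
    (hS : Schedule k α μ ξ ν N)
    (hT : IsTrajectory P F (fun i => α / ((i : ℝ) + K) ^ ξ) k.A k.B k.r x w)
    (hK : ∀ n, K ≤ n → IsLateTime k α μ ξ (stepRate k.D α ν N) n)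
    (hξ : rateExponent k.D ξ < 1) (i : ℕ) :
    let φ := stepRate k.D α ν N
    let ω := k.D * α ^ 2 * N
    let κ := k.comparison (μ / K ^ (ξ / 2))
    let E := mse P x z₀
    E i ≤ E 0 * k.q * κ * Real.exp (-(φ * ((i + K) ^ (1 - rateExponent k.D ξ)
        - K ^ (1 - rateExponent k.D ξ)) / (1 - rateExponent k.D ξ)))
      + 2 * ω * κ / (φ * (i + K) ^ (ξ / (2 * k.D))) := by
  intro φ ω κ E
  obtain ⟨u, hu, hrec⟩ := h.exists_isLyapunovSequence_diminishing hS hT hK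
  have hlate : ∀ i : ℕ, IsLateTime k α μ ξ φ (i + K) := fun i =>
    hK _ (le_add_of_nonneg_left i.cast_nonneg)
  have hφ : 0 < φ := stepRate_pos k.D_pos hS.step_pos hS.decay_pos hS.noise_pos
  have hω : 0 ≤ ω := mul_nonneg (mul_nonneg k.D_pos.le (sq_nonneg α)) hS.noise_pos.le
  rw [← rateExponent_add k.D_pos] at hrec
  refine (hu.le_of_le (Real.exp_pos _).le (le_of_subharmonic_recursion
    (one_pos.trans_le (hK K le_rfl).one_le) (rateExponent_pos k.one_le_D hS.exponent_pos).le hξ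
    (div_nonneg hS.exponent_pos.le (by linarith [k.D_pos])) hφ hω (hu.nonneg 0)
    (fun i => (hlate i).rate.trans (by norm_num)) (fun i => (hlate i).exponent_le hξ)
    hrec i)).trans_eq ?_
  ring

end IsProximalLyapunov

end DiminishingSteps

section ConstantSteps

/-! ### Constant steps -/

theorem rpow_mul_rpow_le {D α μ : ℝ} (hD : 1 ≤ D) (hα : 0 < α) (hμ : 0 < μ) :
    α ^ (1 / D) * (α ^ 2 / μ) ^ (1 - 1 / D)
      ≤ (α * μ + α ^ 2 / μ) ^ (1 - 1 / (3 * D)) := by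
  have hD' : 0 ≤ 1 - 1 / D := sub_nonneg.2 ((div_le_one (by positivity)).2 hD)
  have hle : α ^ 2 / μ ≤ α * μ + α ^ 2 / μ := le_add_of_nonneg_left (by positivity)
  have hcube : α ^ (3 : ℝ) ≤ (α * μ + α ^ 2 / μ) ^ (2 : ℝ) := by
    calc α ^ (3 : ℝ) = α * μ * (α ^ 2 / μ) := by
          norm_cast
          field_simp
      _ ≤ (α * μ + α ^ 2 / μ) * (α * μ + α ^ 2 / μ) := by
          gcongr
          exact le_add_of_nonneg_right (by positivity)
      _ = (α * μ + α ^ 2 / μ) ^ (2 : ℝ) := by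
          norm_cast
          ring
  set s := α * μ + α ^ 2 / μ
  have hs : 0 < s := by positivity
  calc α ^ (1 / D) * (α ^ 2 / μ) ^ (1 - 1 / D)
      = (α ^ (3 : ℝ)) ^ (1 / (3 * D)) * (α ^ 2 / μ) ^ (1 - 1 / D) := by
        rw [← Real.rpow_mul hα.le, show 3 * (1 / (3 * D)) = 1 / D by field_simp]
    _ ≤ (s ^ (2 : ℝ)) ^ (1 / (3 * D)) * s ^ (1 - 1 / D) := by gcongr
    _ = s ^ (1 - 1 / (3 * D)) := by
        rw [← Real.rpow_mul hs.le, ← Real.rpow_add hs]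
        congr 1
        field_simp
        ring

theorem stepRate_div_le {D α μ ν N : ℝ} (hD : 1 ≤ D) (hα : 0 < α) (hμ : 0 < μ) (hν : 0 ≤ ν)
    (hN : 0 ≤ N) :
    stepRate D α ν (N / μ) ≤ stepRate D 1 ν N * (α * μ + α ^ 2 / μ) ^ (1 - 1 / (3 * D)) := by
  have hsplit : stepRate D α ν (N / μ)
      = stepRate D 1 ν N * (α ^ (1 / D) * (α ^ 2 / μ) ^ (1 - 1 / D)) := by
    rw [stepRate, stepRate, Real.one_rpow, Real.div_rpow hN hμ.le,
      Real.div_rpow (by positivity) hμ.le, ← Real.rpow_natCast_mul hα.le,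
      show 2 - 1 / D = 1 / D + (2 : ℕ) * (1 - 1 / D) by push_cast; ring, Real.rpow_add hα]
    ring
  rw [hsplit]
  have : 0 ≤ stepRate D 1 ν N := by
    unfold stepRate
    positivity
  gcongr
  exact rpow_mul_rpow_le hD hα hμ

theorem le_one_of_le_mul_rpow {b η θ s φ : ℝ} (hb : 0 ≤ b) (hη : 0 ≤ η) (hθ : 0 ≤ θ) (hθ1 : θ ≤ 1)
    (hs : 0 ≤ s) (hφ : φ ≤ b * s ^ θ) (hsφ : s ≤ η * φ) (hbη : b * η ^ θ < 1) : φ ≤ 1 := by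
  by_contra! hgt
  have hφ0 := one_pos.trans hgt
  refine hφ.not_gt ?_
  calc b * s ^ θ ≤ b * (η * φ) ^ θ := by gcongr
    _ = b * η ^ θ * φ ^ θ := by rw [Real.mul_rpow hη hφ0.le, mul_assoc]
    _ ≤ b * η ^ θ * φ := by
        gcongr
        exact Real.rpow_le_self_of_one_le hgt.le hθ1
    _ < φ := mul_lt_of_lt_one_left hφ0 hbη

/-- A bound `η` on the constant smoothing parameter and on the ratio of `α μ + α² / μ` to the
contraction rate, small enough for the mean envelope to contract when the noise level is at most
`N / μ`. -/
structure IsSmallThreshold (k : DescentConstants) (N η : ℝ) : Prop where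
  pos : 0 < η
  le_one : η ≤ 1
  smoothing : k.IsSmallSmoothing η
  distortion : ((1 + η * k.S) ^ 2) ^ k.D ≤ 4 / 3
  error : (k.L * k.curvature + (k.L ^ 2 + 2 * k.B) * k.comparison 1 / 2) * η ≤ 1 / 4
  rate : stepRate k.D 1 (k.β * (k.p / k.q) ^ k.D) N * η ^ (1 - 1 / (3 * k.D)) < 1

theorem one_sub_one_div_three_mul_pos {D : ℝ} (hD : 1 ≤ D) : 0 < 1 - 1 / (3 * D) := by
  rw [sub_pos, div_lt_one (by positivity)]
  linarith

theorem exists_isSmallThreshold (k : DescentConstants) (N : ℝ) : ∃ η, IsSmallThreshold k N η := by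
  have hlim : ∀ c : ℝ, Tendsto (fun η : ℝ => c * η) (𝓝[>] 0) (𝓝 0) := fun c =>
    (Continuous.tendsto' (by fun_prop) _ _ (mul_zero c)).mono_left nhdsWithin_le_nhds
  have hθ := one_sub_one_div_three_mul_pos k.one_le_D
  have hrate : Tendsto (fun η : ℝ => stepRate k.D 1 (k.β * (k.p / k.q) ^ k.D) N
      * η ^ (1 - 1 / (3 * k.D))) (𝓝[>] 0) (𝓝 0) := by
    have hcont : Continuous fun η : ℝ => η ^ (1 - 1 / (3 * k.D)) :=
      continuous_id.rpow_const fun _ => Or.inr hθ.le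
    refine ((hcont.const_mul _).tendsto' 0 0 ?_).mono_left nhdsWithin_le_nhds
    rw [Real.zero_rpow hθ.ne', mul_zero]
  refine Eventually.exists (f := 𝓝[>] 0) ?_
  filter_upwards [self_mem_nhdsWithin, nhdsWithin_le_nhds (eventually_le_nhds one_pos),
    nhdsWithin_le_nhds (eventually_isSmallSmoothing k),
    nhdsWithin_le_nhds (eventually_distortion_le k),
    (hlim _).eventually_le_const (by norm_num : (0 : ℝ) < 1 / 4),
    hrate.eventually_lt_const one_pos] with η hpos hone hsmoothing hdistortion herror hrate
  exact ⟨hpos, hone, hsmoothing, hdistortion, herror, hrate⟩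

/-- A constant step size `α` and a constant smoothing parameter `μ`, with a decay coefficient `ν`
and a noise level `n` adapted to the constants `k`, which are small with respect to `η`. -/
structure IsSmallStep (k : DescentConstants) (η α μ ν n : ℝ) : Prop where
  step_pos : 0 < α
  smoothing_pos : 0 < μ
  smoothing_le : μ ≤ η
  decay_pos : 0 < ν
  decay : ν ≤ k.β * (k.p / k.q) ^ k.D
  noise : (k.A + 2 * k.B * k.s ^ 2) / (2 * μ) ≤ n
  le_rate : α * μ + α ^ 2 / μ ≤ η * stepRate k.D α ν n

namespace IsSmallStep

variable {k : DescentConstants} {N η α μ ν n : ℝ}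

theorem noise_pos (h : IsSmallStep k η α μ ν n) : 0 < n :=
  (div_pos k.noise_pos (mul_pos two_pos h.smoothing_pos)).trans_le h.noise

theorem stepRate_le_one (h : IsSmallStep k η α μ ν n) (hη : IsSmallThreshold k N η)
    (hN : n ≤ N / μ) : stepRate k.D α ν n ≤ 1 := by
  have hμ := h.smoothing_pos
  have hα := h.step_pos
  have hνmax := h.decay_pos.le.trans h.decay
  have hN0 : 0 < N := (div_pos_iff_of_pos_right hμ).1 (h.noise_pos.trans_le hN)
  have hb : 0 < stepRate k.D 1 (k.β * (k.p / k.q) ^ k.D) N :=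
    stepRate_pos k.D_pos one_pos (h.decay_pos.trans_le h.decay) hN0
  refine le_one_of_le_mul_rpow hb.le hη.pos.le
    (one_sub_one_div_three_mul_pos k.one_le_D).le
    (sub_le_self _ (one_div_nonneg.2 (by linarith [k.D_pos]))) (by positivity) ?_ h.le_rate hη.rate
  exact (stepRate_le_stepRate k.one_le_D hα.le h.decay_pos.le h.noise_pos.le h.decay hN).trans
    (stepRate_div_le k.one_le_D hα hμ hνmax hN0.le)

theorem error_le (h : IsSmallStep k η α μ ν n) (hη : IsSmallThreshold k N η) :
    α * k.L * μ * k.curvature + α ^ 2 * (k.L ^ 2 + 2 * k.B) * k.comparison μ / (2 * μ)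
      ≤ stepRate k.D α ν n / 4 := by
  have hα := h.step_pos
  have hμ := h.smoothing_pos
  have hΛ := k.curvature_pos
  have hκ := k.comparison_pos one_pos
  have hL := k.L_pos
  have hB := k.B_nonneg
  have hφ := stepRate_pos k.D_pos hα h.decay_pos h.noise_pos
  calc _ ≤ α * k.L * μ * k.curvature
        + α ^ 2 * (k.L ^ 2 + 2 * k.B) * k.comparison 1 / (2 * μ) := by
        gcongr
        exact k.comparison_le_comparison (h.smoothing_le.trans hη.le_one)
    _ = k.L * k.curvature * (α * μ)
        + (k.L ^ 2 + 2 * k.B) * k.comparison 1 / 2 * (α ^ 2 / μ) := by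
        field_simp
    _ ≤ k.L * k.curvature * (α * μ + α ^ 2 / μ)
        + (k.L ^ 2 + 2 * k.B) * k.comparison 1 / 2 * (α * μ + α ^ 2 / μ) := by
        gcongr
        · exact le_add_of_nonneg_right (by positivity)
        · exact le_add_of_nonneg_left (by positivity)
    _ = (k.L * k.curvature + (k.L ^ 2 + 2 * k.B) * k.comparison 1 / 2)
        * (α * μ + α ^ 2 / μ) := by ring
    _ ≤ (k.L * k.curvature + (k.L ^ 2 + 2 * k.B) * k.comparison 1 / 2)
        * (η * stepRate k.D α ν n) := by
        gcongr
        exact h.le_rate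
    _ ≤ stepRate k.D α ν n / 4 := by
        linarith [mul_le_mul_of_nonneg_right hη.error hφ.le]

theorem stepCondition (h : IsSmallStep k η α μ ν n) (hη : IsSmallThreshold k N η) :
    StepCondition k α μ ν n where
  step_pos := h.step_pos
  smoothing_pos := h.smoothing_pos
  decay_pos := h.decay_pos
  smoothing := hη.smoothing.mono h.smoothing_pos.le h.smoothing_le
  decay := h.decay
  distortion :=
    (k.distortion_le_distortion h.smoothing_pos.le h.smoothing_le).trans hη.distortion
  error := h.error_le hη
  noise := h.noise

end IsSmallStep

theorem IsProximalLyapunov.mse_le_of_isSmallStep {m : ℕ} {Ω : Type*} {mΩ : MeasurableSpace Ω}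
    {P : Measure Ω} [IsProbabilityMeasure P] {k : DescentConstants}
    {W : EuclideanSpace ℝ (Fin m) → ℝ} {F : EuclideanSpace ℝ (Fin m) → EuclideanSpace ℝ (Fin m)}
    {z₀ : EuclideanSpace ℝ (Fin m)} {x w : ℕ → Ω → EuclideanSpace ℝ (Fin m)} {N η α μ ν n : ℝ}
    (h : IsProximalLyapunov k W F z₀) (hη : IsSmallThreshold k N η)
    (hS : IsSmallStep k η α μ ν n) (hN : n ≤ N / μ)
    (hT : IsTrajectory P F (fun _ => α) k.A k.B k.r x w) (i : ℕ) :
    let φ := stepRate k.D α ν n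
    let ω := k.D * α ^ 2 * n
    let κ := k.comparison μ
    let E := mse P x z₀
    E i ≤ E 0 * k.q * κ * (1 - φ) ^ i + ω * κ / φ := by
  intro φ ω κ E
  have hφ : 0 < φ := stepRate_pos k.D_pos hS.step_pos hS.decay_pos hS.noise_pos
  have hφ1 : φ ≤ 1 := hS.stepRate_le_one hη hN
  have hω : 0 ≤ ω := mul_nonneg (mul_nonneg k.D_pos.le (sq_nonneg α)) hS.noise_pos.le
  let u : ℕ → ℝ := fun i => ∫ y, moreauEnvelope W μ (x i y) ∂P
  have hu : IsLyapunovSequence E u k.q κ :=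
    h.isLyapunovSequence hT (fun _ => hS.smoothing_pos) fun _ => le_rfl
  have hrec : ∀ i, u (i + 1) ≤ (1 - φ) * u i + ω := fun i => by
    refine (h.integral_envelope_succ_le hT (hS.stepCondition hη)).trans ?_
    gcongr ?_ * _ + _
    · exact hu.nonneg i
    · linarith
  refine (hu.le_of_le (pow_nonneg (sub_nonneg.2 hφ1) i)
    (le_of_constant_recursion hφ hφ1 hω hrec i)).trans_eq ?_
  ring

end ConstantSteps

section Constants

/-! ### The constants of the theorem -/

variable {a c γ C C₁ C₂ G A B s α μ μ₀ μ₁ ξ : ℝ}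

theorem gM_pos (ha : 0 < a) (hC₂ : 0 < C₂) (hG : 0 < G) : 0 < gM a G C₂ := by
  unfold gM
  positivity

theorem nu4_pos (ha : 0 < a) (hγ : 0 < γ) (hC₁ : 0 < C₁) (hC₂ : 0 < C₂) (hG : 0 < G)
    (hμ₀ : 0 ≤ μ₀) : 0 < nu4 a c γ C₁ C₂ G μ₀ := by
  have := gM_pos ha hC₂ hG
  unfold nu4
  positivity

theorem nu4_le_nu4 (ha : 0 < a) (hγ : 0 < γ) (hC₁ : 0 < C₁) (hC₂ : 0 < C₂) (hG : 0 < G)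
    (hμ₀ : 0 ≤ μ₀) (hle : μ₀ ≤ μ₁) : nu4 a c γ C₁ C₂ G μ₁ ≤ nu4 a c γ C₁ C₂ G μ₀ := by
  have := gM_pos ha hC₂ hG
  unfold nu4
  gcongr

theorem nu4_zero (ha : a ≠ 0) (hC₁ : 0 ≤ C₁) (hC₂ : 0 ≤ C₂) :
    nu4 a c γ C₁ C₂ G 0 = 2 * γ / a * (C₁ ^ (2 / a) / C₂ ^ (2 / a)) ^ dac a c := by
  have hexp : 2 / a * dac a c = c - 1 + 2 / a := by
    unfold dac
    field_simp
  rw [← Real.div_rpow hC₁ hC₂, ← Real.rpow_mul (by positivity), hexp, nu4, zero_mul, add_zero,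
    one_pow, mul_one, mul_div_right_comm]

theorem noiseLevel_pos (hAB : 0 < A + 2 * B * s ^ 2) (hμ : 0 < μ) :
    0 < noiseLevel a C C₂ G A B s μ μ₀ := by
  unfold noiseLevel nC
  positivity

theorem noiseLevel_le_noiseLevel (hAB : 0 ≤ A + 2 * B * s ^ 2) (hμ : 0 ≤ μ) (hμ₀ : 0 ≤ μ₀)
    (hle : μ₀ ≤ μ₁) : noiseLevel a C C₂ G A B s μ μ₀ ≤ noiseLevel a C C₂ G A B s μ μ₁ := by
  unfold noiseLevel nC
  gcongr

theorem noiseLevel_eq_div :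
    noiseLevel a C C₂ G A B s μ μ₀ = noiseLevel a C C₂ G A B s 1 μ₀ / μ := by
  rw [noiseLevel, noiseLevel, div_div, mul_one]

theorem noiseLevel_zero : noiseLevel a C C₂ G A B s μ 0 = nC C A B s / (2 * μ) := by
  rw [noiseLevel, zero_pow two_ne_zero, zero_mul, zero_add, one_mul]

theorem le_nC (hAB : 0 ≤ A + 2 * B * s ^ 2) : A + 2 * B * s ^ 2 ≤ nC C A B s :=
  le_mul_of_one_le_left hAB (le_add_of_nonneg_left (sq_nonneg C))

theorem rateExponent_dExp (hD : 1 ≤ dac a c) : rateExponent (dac a c) (2 * dExp a c / 3) = 1 := by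
  have : 3 * dac a c - 1 ≠ 0 := by linarith
  have : dac a c ≠ 0 := by linarith
  unfold rateExponent dExp
  field_simp

theorem rateExponent_strictMono {D : ℝ} (hD : 1 ≤ D) : StrictMono (rateExponent D) := by
  intro ξ ξ' hlt
  have : 0 < 3 * D - 1 := by linarith
  unfold rateExponent
  gcongr

theorem phi_mem_Icc (ha : 0 < a) (hc : 1 ≤ c) (hγ : 0 < γ) (hC₁ : 0 < C₁) (hC₂ : 0 < C₂)
    (hG : 0 < G) (hAB : 0 < A + 2 * B * s ^ 2) (hα : 0 ≤ α) (hμ : 0 < μ) (hμ₀ : 0 ≤ μ₀)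
    (hle : μ₀ ≤ μ₁) :
    phi a c γ C C₁ C₂ G A B s α μ μ₀ ∈ Set.Icc
      (stepRate (dac a c) α (nu4 a c γ C₁ C₂ G μ₁) (noiseLevel a C C₂ G A B s μ 0))
      (stepRate (dac a c) α (nu4 a c γ C₁ C₂ G 0) (noiseLevel a C C₂ G A B s μ μ₁)) :=
  have hD := one_le_dac ha.le hc
  ⟨stepRate_le_stepRate hD hα (nu4_pos ha hγ hC₁ hC₂ hG (hμ₀.trans hle)).le
      (noiseLevel_pos hAB hμ).le (nu4_le_nu4 ha hγ hC₁ hC₂ hG hμ₀ hle)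
      (noiseLevel_le_noiseLevel hAB.le hμ.le le_rfl hμ₀),
    stepRate_le_stepRate hD hα (nu4_pos ha hγ hC₁ hC₂ hG hμ₀).le (noiseLevel_pos hAB hμ).le
      (nu4_le_nu4 ha hγ hC₁ hC₂ hG le_rfl hμ₀)
      (noiseLevel_le_noiseLevel hAB.le hμ.le hμ₀ hle)⟩

theorem exists_forall_isLateTime_phi (k : DescentConstants) (ha : 0 < a) (hc : 1 ≤ c) (hγ : 0 < γ)
    (hC₁ : 0 < C₁) (hC₂ : 0 < C₂) (hG : 0 < G) (hAB : 0 < A + 2 * B * s ^ 2) (hα : 0 < α)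
    (hμ : 0 < μ) (hξ : 0 < ξ) :
    ∃ K₀ : ℝ, 1 ≤ K₀ ∧ ∀ K, K₀ ≤ K → ∀ n, K ≤ n →
      IsLateTime k α μ ξ (phi a c γ C C₁ C₂ G A B s α μ (μ / K ^ (ξ / 2))) n :=
  exists_forall_isLateTime hξ
    (stepRate_pos (one_pos.trans_le (one_le_dac ha.le hc)) hα (nu4_pos ha hγ hC₁ hC₂ hG hμ.le)
      (noiseLevel_pos hAB hμ))
    fun _ hK => phi_mem_Icc ha hc hγ hC₁ hC₂ hG hAB hα.le hμ (by positivity)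
      (div_le_self hμ.le (Real.one_le_rpow hK (by positivity)))

theorem noiseLevel_le_div (hAB : 0 ≤ A + 2 * B * s ^ 2) (hμ : 0 ≤ μ) (hμ1 : μ ≤ 1) :
    noiseLevel a C C₂ G A B s μ μ ≤ noiseLevel a C C₂ G A B s 1 1 / μ := by
  rw [noiseLevel_eq_div]
  gcongr
  exact noiseLevel_le_noiseLevel hAB zero_le_one hμ hμ1

variable {r ρ : ℝ} (ha : 0 < a) (hc : 1 ≤ c) (hγ : 0 < γ) (hC : 0 < C) (hC₁ : 0 < C₁)
  (hC₂ : 0 < C₂) (hG : 0 < G) (hB : 0 ≤ B) (hAB : 0 < A + 2 * B * s ^ 2) (hr : r < ρ) (hs : s ≤ ρ)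

theorem schedule_descentConstants (hα : 0 < α) (hμ : 0 < μ) (hξ : 0 < ξ)
    (hξd : ξ ≤ 2 * dExp a c / 3) (hμ₀ : 0 ≤ μ₀) :
    Schedule (descentConstants a c γ C C₁ C₂ G A B s r ρ ha hc hγ hC hC₁ hC₂ hG hB hAB hr hs)
      α μ ξ (nu4 a c γ C₁ C₂ G μ₀) (noiseLevel a C C₂ G A B s μ μ₀) where
  step_pos := hα
  smoothing_pos := hμ
  exponent_pos := hξ
  rateExponent_le_one :=
    have hD := one_le_dac ha.le hc
    ((rateExponent_strictMono hD).monotone hξd).trans_eq (rateExponent_dExp hD)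
  decay_pos := nu4_pos ha hγ hC₁ hC₂ hG hμ₀
  decay := (nu4_le_nu4 ha hγ hC₁ hC₂ hG le_rfl hμ₀).trans_eq (nu4_zero ha.ne' hC₁.le hC₂.le)
  noise := noiseLevel_zero.symm.trans_le (noiseLevel_le_noiseLevel hAB.le hμ.le le_rfl hμ₀)

theorem isSmallStep_descentConstants {η : ℝ} (hα : 0 < α) (hμ : 0 < μ) (hμη : μ ≤ η)
    (hle : α * μ + α ^ 2 / μ ≤ η * phi a c γ C C₁ C₂ G A B s α μ μ) :
    IsSmallStep (descentConstants a c γ C C₁ C₂ G A B s r ρ ha hc hγ hC hC₁ hC₂ hG hB hAB hr hs)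
      η α μ (nu4 a c γ C₁ C₂ G μ) (noiseLevel a C C₂ G A B s μ μ) where
  step_pos := hα
  smoothing_pos := hμ
  smoothing_le := hμη
  decay_pos := nu4_pos ha hγ hC₁ hC₂ hG hμ.le
  decay := (nu4_le_nu4 ha hγ hC₁ hC₂ hG le_rfl hμ.le).trans_eq (nu4_zero ha.ne' hC₁.le hC₂.le)
  noise := calc
    (A + 2 * B * s ^ 2) / (2 * μ) ≤ nC C A B s / (2 * μ) := by
      gcongr
      exact le_nC hAB.le
    _ = noiseLevel a C C₂ G A B s μ 0 := noiseLevel_zero.symm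
    _ ≤ noiseLevel a C C₂ G A B s μ μ := noiseLevel_le_noiseLevel hAB.le hμ.le le_rfl hμ.le
  le_rate := hle

end Constants

end NonsmoothSA

theorem mainTheorem2 {m : ℕ} (xs : EuclideanSpace ℝ (Fin m))
    (a c γ C C₁ C₂ G A B r ρ : ℝ)
    (ha : 0 < a) (hc : 1 ≤ c) (hγ : 0 < γ) (hC : 0 < C) (hC₁ : 0 < C₁) (hC₂ : 0 < C₂)
    (hG : 0 < G) (hA : 0 ≤ A) (hB : 0 ≤ B) (hAB : 0 < A + 2 * B * ‖xs‖ ^ 2)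
    (hr : r < ρ) (hxs : ‖xs‖ ≤ ρ) :
    -- diminishing steps `α / (k + K)^ξ`, with `μ_k = μ / (k + K)^(ξ/2)` and `K` large
    (∀ α μ ξ : ℝ, 0 < α → 0 < μ → 0 < ξ → ξ ≤ 2 * NonsmoothSA.dExp a c / 3 →
      ∃ K₀ : ℝ, 1 ≤ K₀ ∧ ∀ K : ℝ, K₀ ≤ K →
        ∀ (V : EuclideanSpace ℝ (Fin m) → ℝ)
          (F : EuclideanSpace ℝ (Fin m) → EuclideanSpace ℝ (Fin m)),
        NonsmoothSA.SystemAssumptions V F xs a c γ C C₁ C₂ G ρ →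
        ∀ (Ω : Type*) [MeasurableSpace Ω] (P : Measure Ω) [IsProbabilityMeasure P]
          (x w : ℕ → Ω → EuclideanSpace ℝ (Fin m)),
        NonsmoothSA.IsTrajectory P F (fun k => α / ((k : ℝ) + K) ^ ξ) A B r x w →
        let D : ℝ := NonsmoothSA.dac a c
        let d : ℝ := NonsmoothSA.dExp a c
        let μ₀ : ℝ := μ / K ^ (ξ / 2)
        let φ : ℝ := NonsmoothSA.phi a c γ C C₁ C₂ G A B ‖xs‖ α μ μ₀
        let ω : ℝ := NonsmoothSA.omega a c C C₂ G A B ‖xs‖ α μ μ₀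
        let κ : ℝ := NonsmoothSA.envelopeConst a C₁ μ₀
        let E : ℕ → ℝ := NonsmoothSA.mse P x xs
        ∀ k : ℕ,
          (ξ = 2 * d / 3 →
            (φ < d - 1 →
              E k ≤ E 0 * C₂ ^ (2 / a) * κ * (K / (k + K)) ^ φ
                + κ * (1 / (k + K) ^ φ * (2 ^ d * ω / (d - 1 - φ)))) ∧
            (φ = d - 1 →
              E k ≤ E 0 * C₂ ^ (2 / a) * κ * (K / (k + K)) ^ φ
                + κ * (Real.log (k + K) / (k + K) ^ (d - 1) * (2 ^ d * ω))) ∧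
            (d - 1 < φ →
              E k ≤ E 0 * C₂ ^ (2 / a) * κ * (K / (k + K)) ^ φ
                + κ * (1 / (k + K) ^ (d - 1) *
                    (Real.exp 1 * 2 ^ d * ω / (φ - (d - 1)))))) ∧
          (ξ < 2 * d / 3 →
            E k ≤ E 0 * C₂ ^ (2 / a) * κ *
                Real.exp (-(φ * ((k + K) ^ (1 - (3 * D - 1) * ξ / (2 * D))
                    - K ^ (1 - (3 * D - 1) * ξ / (2 * D)))
                  / (1 - (3 * D - 1) * ξ / (2 * D))))
              + 2 * ω * κ / (φ * (k + K) ^ (ξ / (2 * D))))) ∧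
    -- constant steps (`ξ = 0`), with `α` and `μ` suitably small
    (∃ η : ℝ, 0 < η ∧ ∀ α μ : ℝ, 0 < α → 0 < μ → μ ≤ η →
      α * μ + α ^ 2 / μ ≤ η * NonsmoothSA.phi a c γ C C₁ C₂ G A B ‖xs‖ α μ μ →
        ∀ (V : EuclideanSpace ℝ (Fin m) → ℝ)
          (F : EuclideanSpace ℝ (Fin m) → EuclideanSpace ℝ (Fin m)),
        NonsmoothSA.SystemAssumptions V F xs a c γ C C₁ C₂ G ρ →
        ∀ (Ω : Type*) [MeasurableSpace Ω] (P : Measure Ω) [IsProbabilityMeasure P]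
          (x w : ℕ → Ω → EuclideanSpace ℝ (Fin m)),
        NonsmoothSA.IsTrajectory P F (fun _ => α) A B r x w →
        let φ : ℝ := NonsmoothSA.phi a c γ C C₁ C₂ G A B ‖xs‖ α μ μ
        let ω : ℝ := NonsmoothSA.omega a c C C₂ G A B ‖xs‖ α μ μ
        let κ : ℝ := NonsmoothSA.envelopeConst a C₁ μ
        let E : ℕ → ℝ := NonsmoothSA.mse P x xs
        ∀ k : ℕ, E k ≤ E 0 * C₂ ^ (2 / a) * κ * (1 - φ) ^ k + ω * κ / φ) := by
  let k := NonsmoothSA.descentConstants a c γ C C₁ C₂ G A B ‖xs‖ r ρ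
    ha hc hγ hC hC₁ hC₂ hG hB hAB hr hxs
  have hcrit := NonsmoothSA.rateExponent_dExp (a := a) (c := c) k.one_le_D
  refine ⟨fun α μ ξ hα hμ hξ hξd => ?_, ?_⟩
  · obtain ⟨K₀, hK₀, hlate⟩ := NonsmoothSA.exists_forall_isLateTime_phi (C := C) k
      ha hc hγ hC₁ hC₂ hG hAB hα hμ hξ
    refine ⟨K₀, hK₀, fun K hK V F h Ω _ P _ x w hT => ?_⟩
    have hK0 : 0 ≤ K := zero_le_one.trans (hK₀.trans hK)
    have hL := h.isProximalLyapunov ha hc hγ hC hC₁ hC₂ hG hB hAB hr hxs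
    have hS := NonsmoothSA.schedule_descentConstants (μ₀ := μ / K ^ (ξ / 2))
      ha hc hγ hC hC₁ hC₂ hG hB hAB hr hxs hα hμ hξ hξd (by positivity)
    refine fun i => ⟨fun heq => ?_, fun hlt => ?_⟩
    · exact hL.mse_le_of_rateExponent_eq_one hS hT (hlate K hK) (by rwa [heq]) (by rw [heq]; ring) i
    · exact hL.mse_le_of_rateExponent_lt_one hS hT (hlate K hK)
        ((NonsmoothSA.rateExponent_strictMono k.one_le_D hlt).trans_eq hcrit) i
  · obtain ⟨η, hη⟩ := NonsmoothSA.exists_isSmallThreshold k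
      (NonsmoothSA.noiseLevel a C C₂ G A B ‖xs‖ 1 1)
    refine ⟨η, hη.pos, fun α μ hα hμ hμη hle V F h Ω _ P _ x w hT i => ?_⟩
    exact (h.isProximalLyapunov ha hc hγ hC hC₁ hC₂ hG hB hAB hr hxs).mse_le_of_isSmallStep hη
      (NonsmoothSA.isSmallStep_descentConstants ha hc hγ hC hC₁ hC₂ hG hB hAB hr hxs
        hα hμ hμη hle)
      (NonsmoothSA.noiseLevel_le_div hAB.le hμ.le (hμη.trans hη.le_one)) hT i
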